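/- Let $n\in\mathbb{N}$, let $\Delta_n=\{p\in\mathbb{R}^n: p^j>0,\ \sum_j p^j=1\}$ be the open simplex with the Fisher–Rao metric $\mathrm{G}_{FR}=\sum_j \frac{1}{p^j}\,\mathrm{d}p^j\otimes \mathrm{d}p^j$, and let $\mathscr{C}_n=\{p\in\Delta_n: p^1<\dots<p^n\}$. For $p\in\Delta_n$ and $a\in\mathbb{R}^n$ with $\sum_j a^j=0$ put $\|a\|=\big(\sum_j (a^j)^2/p^j\big)^{1/2}$ and $$p_a^j(t)=\cos^2\!\Big(\tfrac{t}{2}\|a\|\Big)\,p^j+\frac{\sin^2\!\big(\tfrac t2\|a\|\big)}{\|a\|^2}\,\frac{a^ja^j}{p^j}+\frac{\sin(t\|a\|)}{\|a\|}\,a^j ,$$ with $p_a(t)=p$ for all $t$ if $a=0$. Let $\mathscr{S}_{md}$ be the manifold of positive definite complex $n\times n$ matrices of trace one with $n$ distinct eigenvalues, with tangent space at each point the traceless Hermitian matrices. For a function $f:(0,\infty)\to(0,\infty)$ that is operator monotone with $f(x)=x f(x^{-1})$ and $f(1)=1$, let $\mathrm{G}_f$ be the monotone metric $(\mathrm{G}_f)_\rho(v,w)=\mathrm{Tr}\big(v^\dagger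 (K^f_\rho)^{-1}(w)\big)$, where $K_\rho^f=f(L_\rho R_{\rho^{-1}})R_\rho$, $L_\rho(x)=\rho x$, $R_\rho(x)=x\rho$. (1) For $p\in\Delta_n$ and $a$ as above, let $J$ be the largest interval containing $0$ on which $p_a(t)\in\Delta_n$. Then $J$ is open, $p_a(0)=p$, $p_a'(0)=a$, and $p_a$ is a geodesic of $(\Delta_n,\mathrm{G}_{FR})$ on $J$. Every geodesic of $(\Delta_n,\mathrm{G}_{FR})$ that is defined on an open interval $I\ni 0$ and has initial point $p$ and initial velocity $a$ satisfies $I\subseteq J$ and equals $p_a$ on $I$. (2) For $p\in\mathscr{C}_n$, $a$ as above and $U\in SU(n)$, let $J$ be the largest interval containing $0$ on which $p_a(t)\in\mathscr{C}_n$. Then $J$ is open, and for every $f$ as above the curve $$t\longmapsto U\,\mathrm{diag}\big(p_a^1(t),\dots,p_a^n(t)\big)\,U^\dagger,\qquad t\in J,$$ is a geodesic of $(\mathscr{S}_{md},\mathrm{G}_f)$. Here a geodesic is a curve with $\nabla_{\gamma'}\gamma'=0$ for the Levi-Civita connection. -/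

import Mathlib

open scoped ComplexOrder

noncomputable section

namespace UniversalGeodesics

/-! ## Geodesics of a Riemannian metric on an open piece of an affine space

The manifold `S` is an open subset of an affine subspace of `E` whose direction is `V`, so every
tangent space is identified with `V`, and `g ρ u v` is the metric at `ρ ∈ S`. -/

section Geodesic

variable {E : Type*} [AddCommGroup E] [Module ℝ E] [TopologicalSpace E]

/-- The function `s ↦ g_{ρ + s x}(y, z)`. -/
def alongLine (g : E → E → E → ℝ) (ρ x y z : E) : ℝ → ℝ :=
  fun s => g (ρ + s • x) y z

/-- The directional derivative `(D_x g)_ρ(y, z)` of the metric coefficients. -/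
def metricDeriv (g : E → E → E → ℝ) (ρ x y z : E) : ℝ :=
  deriv (alongLine g ρ x y z) 0

/-- Christoffel symbols of the first kind (Koszul formula for the constant fields `x, y, z`). -/
def christoffel (g : E → E → E → ℝ) (ρ x y z : E) : ℝ :=
  (metricDeriv g ρ x y z + metricDeriv g ρ y x z - metricDeriv g ρ z x y) / 2

/-- `γ` is, on the open set `I` of times, an affinely parametrized geodesic of `(S, g)`: it is a
twice differentiable curve in `S` and `∇_{γ'} γ' = 0` for the Levi-Civita connection, that is
`g_γ(γ'', w) + Γ_γ(γ', γ'; w) = 0` for every tangent vector `w`. The derivatives of `g` that enter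
are required to exist. -/
def IsGeodesicOn (S V : Set E) (g : E → E → E → ℝ) (I : Set ℝ) (γ : ℝ → E) : Prop :=
  (∀ t ∈ I, γ t ∈ S ∧ DifferentiableAt ℝ γ t ∧ DifferentiableAt ℝ (deriv γ) t) ∧
  ∀ t ∈ I, ∀ w ∈ V,
    DifferentiableAt ℝ (alongLine g (γ t) (deriv γ t) (deriv γ t) w) 0 ∧
    DifferentiableAt ℝ (alongLine g (γ t) w (deriv γ t) (deriv γ t)) 0 ∧
    g (γ t) (deriv (deriv γ) t) w + christoffel g (γ t) (deriv γ t) (deriv γ t) w = 0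

end Geodesic

/-! ## The simplex and the Fisher-Rao metric -/

/-- The open simplex. -/
def simplex (n : ℕ) : Set (Fin n → ℝ) := {p | (∀ j, 0 < p j) ∧ ∑ j, p j = 1}

/-- The tangent space of the simplex. -/
def simplexTangent (n : ℕ) : Set (Fin n → ℝ) := {a | ∑ j, a j = 0}

/-- The Weyl chamber `p₁ < p₂ < ⋯ < pₙ` of the open simplex. -/
def weylChamber (n : ℕ) : Set (Fin n → ℝ) := {p | p ∈ simplex n ∧ StrictMono p}

/-- The Fisher-Rao metric `∑ⱼ dpʲ ⊗ dpʲ / pʲ`. -/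
def fisherRao {n : ℕ} (p a b : Fin n → ℝ) : ℝ := ∑ j, a j * b j / p j

/-- The Fisher-Rao norm of a tangent vector `a` at `p`. -/
def frNorm {n : ℕ} (p a : Fin n → ℝ) : ℝ := √(fisherRao p a a)

/-- The explicit curve with initial point `p` and initial velocity `a`; for `a = 0` the conventions
for division by zero make it the constant curve `p`. -/
def frCurve {n : ℕ} (p a : Fin n → ℝ) (t : ℝ) : Fin n → ℝ := fun j =>
  Real.cos (t / 2 * frNorm p a) ^ 2 * p j
    + Real.sin (t / 2 * frNorm p a) ^ 2 / frNorm p a ^ 2 * (a j * a j / p j)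
    + Real.sin (t * frNorm p a) / frNorm p a * a j

/-! ## States and monotone metrics -/

/-- Faithful states with non-degenerate spectrum: positive definite, of unit trace, all eigenvalues
simple. -/
def nondegenerateStates (n : ℕ) : Set (Matrix (Fin n) (Fin n) ℂ) :=
  {ρ | ρ.PosDef ∧ ρ.trace = 1 ∧ ρ.charpoly.roots.Nodup}

/-- The tangent space of the manifold of faithful states: traceless Hermitian matrices. -/
def stateTangent (n : ℕ) : Set (Matrix (Fin n) (Fin n) ℂ) :=
  {v | v.IsHermitian ∧ v.trace = 0}

/-- `f` is operator monotone on `(0, ∞)`. -/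
def OperatorMonotone (f : ℝ → ℝ) : Prop :=
  ∀ (k : ℕ) (A B : Matrix (Fin k) (Fin k) ℂ), A.PosDef → B.PosDef →
    (B - A).PosSemidef → (cfc f B - cfc f A).PosSemidef

/-- The functions on `(0, ∞)` that label the monotone metrics (values elsewhere play no role). -/
structure IsPetzFunction (f : ℝ → ℝ) : Prop where
  pos : ∀ x, 0 < x → 0 < f x
  operatorMonotone : OperatorMonotone f
  symm : ∀ x, 0 < x → f x = x * f x⁻¹
  map_one : f 1 = 1

/-- A super-operator on `n × n` matrices. -/
abbrev SuperOp (n : ℕ) := Module.End ℂ (Matrix (Fin n) (Fin n) ℂ)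

/-- Functional calculus `f(Φ)` of a super-operator that is self-adjoint for the Hilbert-Schmidt
product, computed in the matrix units, which are a Hilbert-Schmidt orthonormal basis. -/
def superFun {n : ℕ} (f : ℝ → ℝ) (Φ : SuperOp n) : SuperOp n :=
  Matrix.toLin (Matrix.stdBasis ℂ (Fin n) (Fin n)) (Matrix.stdBasis ℂ (Fin n) (Fin n))
    (cfc f (LinearMap.toMatrix (Matrix.stdBasis ℂ (Fin n) (Fin n))
      (Matrix.stdBasis ℂ (Fin n) (Fin n)) Φ))

/-- `K_ρ = f(L_ρ R_{ρ⁻¹}) R_ρ`, where `L_ρ a = ρ a` and `R_ρ a = a ρ`. -/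
def petzK {n : ℕ} (f : ℝ → ℝ) (ρ : Matrix (Fin n) (Fin n) ℂ) : SuperOp n :=
  superFun f (LinearMap.mulLeft ℂ ρ ∘ₗ LinearMap.mulRight ℂ ρ⁻¹) ∘ₗ LinearMap.mulRight ℂ ρ

/-- The monotone metric `(G_f)_ρ(v, w) = Tr(v† K_ρ⁻¹ w)`, which is real on Hermitian `v, w`. -/
def monotoneMetric {n : ℕ} (f : ℝ → ℝ) (ρ v w : Matrix (Fin n) (Fin n) ℂ) : ℝ :=
  (Matrix.trace (v.conjTranspose * (Ring.inverse (petzK f ρ)) w)).re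

/-- The unfolding map `π(U, p) = U diag(p) U†`. -/
def unfolding {n : ℕ} (U : Matrix.specialUnitaryGroup (Fin n) ℂ) (p : Fin n → ℝ) :
    Matrix (Fin n) (Fin n) ℂ :=
  (U : Matrix (Fin n) (Fin n) ℂ) * Matrix.diagonal (fun j => (p j : ℂ))
    * (U : Matrix (Fin n) (Fin n) ℂ).conjTranspose

/-- The largest interval of times around `0` during which the curve `c` stays in `S`. -/
def lifetime {X : Type*} (S : Set X) (c : ℝ → X) : Set ℝ := connectedComponentIn (c ⁻¹' S) 0

end UniversalGeodesics

end

/-! Substituting `p = y²` turns the simplex into the positive part of the unit sphere and Fisher–Rao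
into four times the round metric, so geodesics are great circles. The explicit curve is the
coordinatewise square of such a circle, `frAmp`, which satisfies `y'' = -(‖a‖/2)² y`. Conversely the
geodesic equation fixes `y''/y` up to a multiplier common to all indices; the constraint `∑ q = 1`
and conservation of speed identify it, so `√q` solves the same oscillator equation and
`eq_zero_of_harmonic` gives uniqueness.

For a monotone metric, `monotoneMetric_conj` writes `G_f` in an eigenbasis of the state as a
weighted sum over matrix entries. When the velocity is diagonal in that basis, `f 1 = 1` reduces the
metric to Fisher–Rao, and only the diagonal of the test vector `w` enters. The remaining term is the
derivative of `G_f(x, x)` in a direction `w` that may move the eigenvectors. It is found without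
differentiating `f` or the eigenvectors: `harmonic_le` and `le_arithmetic` trap `G_f(x, x)` between
two explicit functions independent of `f`. When `x` commutes with the state these touch with equal
derivatives (`HasDerivAt.squeeze`). Hence the geodesic equation tested on `w` is the Fisher–Rao one
tested on the diagonal of `w`, for every `f`. -/

noncomputable section

namespace UniversalGeodesics

/-! ### Fisher–Rao geodesics as squares of great circles -/

section FisherRao

open Filter Topology

variable {n : ℕ}

theorem fisherRao_self_nonneg {p : Fin n → ℝ} (hp : ∀ j, 0 < p j) (a : Fin n → ℝ) :
    0 ≤ fisherRao p a a :=
  Finset.sum_nonneg fun j _ => div_nonneg (mul_self_nonneg _) (hp j).le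

theorem frNorm_sq {p : Fin n → ℝ} (hp : ∀ j, 0 < p j) (a : Fin n → ℝ) :
    frNorm p a ^ 2 = fisherRao p a a :=
  Real.sq_sqrt (fisherRao_self_nonneg hp a)

theorem eq_zero_of_frNorm_eq_zero {p : Fin n → ℝ} (hp : ∀ j, 0 < p j) {a : Fin n → ℝ}
    (h : frNorm p a = 0) : a = 0 := by
  have h0 : fisherRao p a a = 0 := by rw [← frNorm_sq hp, h]; simp
  have h1 := (Finset.sum_eq_zero_iff_of_nonneg
    (fun j _ => div_nonneg (mul_self_nonneg (a j)) (hp j).le)).1 h0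
  funext j
  have := h1 j (Finset.mem_univ j)
  rcases div_eq_zero_iff.1 this with h2 | h2
  · exact mul_self_eq_zero.1 h2
  · exact absurd h2 (hp j).ne'

/-- The square root of `frCurve`: a uniform motion on a great circle of the unit sphere. -/
def frAmp (p a : Fin n → ℝ) (j : Fin n) (t : ℝ) : ℝ :=
  Real.cos (t / 2 * frNorm p a) * √(p j)
    + Real.sin (t / 2 * frNorm p a) / frNorm p a * (a j / √(p j))

/-- The velocity of `frAmp`. -/
def frAmpVel (p a : Fin n → ℝ) (j : Fin n) (t : ℝ) : ℝ :=
  -(frNorm p a / 2) * Real.sin (t / 2 * frNorm p a) * √(p j)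
    + Real.cos (t / 2 * frNorm p a) / 2 * (a j / √(p j))

theorem frCurve_eq_sq {p : Fin n → ℝ} (hp : ∀ j, 0 < p j) (a : Fin n → ℝ) (t : ℝ) (j : Fin n) :
    frCurve p a t j = frAmp p a j t ^ 2 := by
  have hs : √(p j) ≠ 0 := (Real.sqrt_pos.2 (hp j)).ne'
  have h2 : √(p j) ^ 2 = p j := Real.sq_sqrt (hp j).le
  have h3 : t * frNorm p a = 2 * (t / 2 * frNorm p a) := by ring
  simp only [frCurve, frAmp]
  rw [h3, Real.sin_two_mul]
  generalize t / 2 * frNorm p a = θ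
  generalize √(p j) = s at *
  rw [← h2]
  simp only [div_eq_mul_inv]
  field_simp
  ring

theorem hasDerivAt_frAmp {p : Fin n → ℝ} (hp : ∀ j, 0 < p j) (a : Fin n → ℝ) (j : Fin n)
    (t : ℝ) : HasDerivAt (frAmp p a j) (frAmpVel p a j t) t := by
  have h0 : HasDerivAt (fun s : ℝ => s / 2 * frNorm p a) (1 / 2 * frNorm p a) t :=
    ((hasDerivAt_id t).div_const 2).mul_const _
  have h1 := (h0.cos.mul_const (√(p j))).add
    ((h0.sin.div_const (frNorm p a)).mul_const (a j / √(p j)))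
  refine h1.congr_deriv ?_
  rw [frAmpVel]
  -- At norm zero the quotient by the norm is zero by convention, whereas `frAmpVel` keeps a term in
  -- `a j`; positivity of `p` forces `a = 0`, which reconciles them.
  by_cases hr : frNorm p a = 0
  · rw [hr]
    simp [eq_zero_of_frNorm_eq_zero hp hr]
  · field_simp

theorem hasDerivAt_frAmpVel (p a : Fin n → ℝ) (j : Fin n) (t : ℝ) :
    HasDerivAt (frAmpVel p a j) (-(frNorm p a ^ 2 / 4) * frAmp p a j t) t := by
  have h0 : HasDerivAt (fun s : ℝ => s / 2 * frNorm p a) (1 / 2 * frNorm p a) t :=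
    ((hasDerivAt_id t).div_const 2).mul_const _
  have h1 := ((h0.sin.const_mul (-(frNorm p a / 2))).mul_const (√(p j))).add
    ((h0.cos.div_const 2).mul_const (a j / √(p j)))
  refine h1.congr_deriv ?_
  rw [frAmp]
  by_cases hr : frNorm p a = 0
  · simp [hr]
  · field_simp
    ring

/-- The velocity of `frCurve`. -/
def frVel (p a : Fin n → ℝ) (t : ℝ) : Fin n → ℝ := fun j =>
  2 * frAmp p a j t * frAmpVel p a j t

/-- The acceleration of `frCurve`. -/
def frAcc (p a : Fin n → ℝ) (t : ℝ) : Fin n → ℝ := fun j =>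
  2 * frAmpVel p a j t ^ 2 - frNorm p a ^ 2 / 2 * frAmp p a j t ^ 2

theorem hasDerivAt_frCurve {p : Fin n → ℝ} (hp : ∀ j, 0 < p j) (a : Fin n → ℝ) (t : ℝ) :
    HasDerivAt (frCurve p a) (frVel p a t) t := by
  refine hasDerivAt_pi.2 fun j => ?_
  have h : (fun s => frCurve p a s j) = fun s => frAmp p a j s ^ 2 :=
    funext fun s => frCurve_eq_sq hp a s j
  rw [h]
  refine ((hasDerivAt_frAmp hp a j t).pow 2).congr_deriv ?_
  simp [frVel]

theorem hasDerivAt_frVel {p : Fin n → ℝ} (hp : ∀ j, 0 < p j) (a : Fin n → ℝ) (t : ℝ) :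
    HasDerivAt (frVel p a) (frAcc p a t) t := by
  refine hasDerivAt_pi.2 fun j => ?_
  refine (((hasDerivAt_frAmp hp a j t).const_mul 2).mul (hasDerivAt_frAmpVel p a j t)).congr_deriv ?_
  simp only [frAcc]
  ring

theorem sum_frCurve {p a : Fin n → ℝ} (hp : p ∈ simplex n) (ha : a ∈ simplexTangent n) (t : ℝ) :
    ∑ j, frCurve p a t j = 1 := by
  have h1 : ∑ j, a j * a j / p j = frNorm p a ^ 2 := (frNorm_sq hp.1 a).symm
  have ha' : ∑ j, a j = 0 := ha
  simp only [frCurve, Finset.sum_add_distrib, ← Finset.mul_sum]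
  rw [h1, ha', hp.2]
  by_cases hr : frNorm p a = 0
  · simp [hr]
  · field_simp
    simp [add_comm]

/-- The geodesic equation of the Fisher-Rao metric, coordinate by coordinate. -/
theorem frAcc_sub {p a : Fin n → ℝ} (hp : ∀ j, 0 < p j) {t : ℝ} {j : Fin n}
    (hc : 0 < frCurve p a t j) :
    frAcc p a t j / frCurve p a t j - frVel p a t j ^ 2 / (2 * frCurve p a t j ^ 2)
      = -(frNorm p a ^ 2 / 2) := by
  rw [frCurve_eq_sq hp] at hc ⊢
  have : frAmp p a j t ≠ 0 := by
    intro h; simp [h] at hc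
  simp only [frAcc, frVel]
  field_simp
  ring

theorem frCurve_zero (p a : Fin n → ℝ) : frCurve p a 0 = p := by
  funext j; simp [frCurve]

theorem frVel_zero {p : Fin n → ℝ} (hp : ∀ j, 0 < p j) (a : Fin n → ℝ) : frVel p a 0 = a := by
  funext j
  have hs : √(p j) ≠ 0 := (Real.sqrt_pos.2 (hp j)).ne'
  simp only [frVel, frAmp, frAmpVel]
  simp
  field_simp

theorem continuous_frCurve {p : Fin n → ℝ} (hp : ∀ j, 0 < p j) (a : Fin n → ℝ) :
    Continuous (frCurve p a) :=
  continuous_iff_continuousAt.2 fun t => (hasDerivAt_frCurve hp a t).continuousAt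

theorem isOpen_preimage_simplex {p a : Fin n → ℝ} (hp : p ∈ simplex n)
    (ha : a ∈ simplexTangent n) : IsOpen (frCurve p a ⁻¹' simplex n) := by
  have h : frCurve p a ⁻¹' simplex n = ⋂ j, {t | 0 < frCurve p a t j} := by
    ext t; simp [simplex, sum_frCurve hp ha]
  rw [h]
  exact isOpen_iInter_of_finite fun j =>
    isOpen_lt continuous_const ((continuous_apply j).comp (continuous_frCurve hp.1 a))

theorem isOpen_preimage_weylChamber {p a : Fin n → ℝ} (hp : p ∈ simplex n)
    (ha : a ∈ simplexTangent n) : IsOpen (frCurve p a ⁻¹' weylChamber n) := by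
  have h : frCurve p a ⁻¹' weylChamber n = frCurve p a ⁻¹' simplex n ∩
      ⋂ i, ⋂ j, ⋂ _ : i < j, {t | frCurve p a t i < frCurve p a t j} := by
    ext t; simp [weylChamber, StrictMono]
  rw [h]
  have hc := fun j => (continuous_apply j).comp (continuous_frCurve hp.1 a)
  exact (isOpen_preimage_simplex hp ha).inter <| isOpen_iInter_of_finite fun i =>
    isOpen_iInter_of_finite fun j => isOpen_iInter_of_finite fun _ => isOpen_lt (hc i) (hc j)

theorem hasDerivAt_sum_div_line {p : Fin n → ℝ} (hp : ∀ j, p j ≠ 0) (x y z : Fin n → ℝ) :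
    HasDerivAt (fun s : ℝ => ∑ j, y j * z j / (p j + s * x j))
      (-∑ j, x j * y j * z j / p j ^ 2) 0 := by
  rw [← Finset.sum_neg_distrib]
  refine HasDerivAt.fun_sum fun j _ => ?_
  have h1 : HasDerivAt (fun s : ℝ => p j + s * x j) (x j) 0 := by
    simpa using ((hasDerivAt_id (0 : ℝ)).mul_const (x j)).const_add (p j)
  have h2 := (hasDerivAt_const (0 : ℝ) (y j * z j)).div h1 (by simpa using hp j)
  refine h2.congr_deriv ?_
  simp
  ring

theorem hasDerivAt_alongLine_fisherRao {p : Fin n → ℝ} (hp : ∀ j, p j ≠ 0)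
    (x y z : Fin n → ℝ) :
    HasDerivAt (alongLine fisherRao p x y z) (-∑ j, x j * y j * z j / p j ^ 2) 0 :=
  hasDerivAt_sum_div_line hp x y z

/-- For a curve `q = y²` the bracket equals `2 y''/y`. Its pairing with every `w` of zero sum
vanishes exactly when it does not depend on the index. -/
theorem fisherRao_add_christoffel {p : Fin n → ℝ} (hp : ∀ j, p j ≠ 0) (u x w : Fin n → ℝ) :
    fisherRao p u w + christoffel fisherRao p x x w
      = ∑ j, w j * (u j / p j - x j ^ 2 / (2 * p j ^ 2)) := by
  simp only [christoffel, metricDeriv, (hasDerivAt_alongLine_fisherRao hp _ _ _).deriv, fisherRao,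
    ← Finset.sum_neg_distrib, ← Finset.sum_add_distrib, ← Finset.sum_sub_distrib,
    Finset.sum_div]
  refine Finset.sum_congr rfl fun j _ => ?_
  have := hp j
  field_simp
  ring

theorem isGeodesicOn_frCurve {p a : Fin n → ℝ} (hp : p ∈ simplex n) {J : Set ℝ}
    (hJ : ∀ t ∈ J, frCurve p a t ∈ simplex n) :
    IsGeodesicOn (simplex n) (simplexTangent n) fisherRao J (frCurve p a) := by
  have hd : deriv (frCurve p a) = frVel p a := funext fun t => (hasDerivAt_frCurve hp.1 a t).deriv
  have hd' : deriv (frVel p a) = frAcc p a := funext fun t => (hasDerivAt_frVel hp.1 a t).deriv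
  rw [IsGeodesicOn, hd, hd']
  refine ⟨fun t ht => ⟨hJ t ht, (hasDerivAt_frCurve hp.1 a t).differentiableAt,
    (hasDerivAt_frVel hp.1 a t).differentiableAt⟩, fun t ht w hw => ?_⟩
  have hpos := (hJ t ht).1
  have hne := fun j => (hpos j).ne'
  refine ⟨(hasDerivAt_alongLine_fisherRao hne _ _ _).differentiableAt,
    (hasDerivAt_alongLine_fisherRao hne _ _ _).differentiableAt, ?_⟩
  rw [fisherRao_add_christoffel hne]
  simp only [frAcc_sub hp.1 (hpos _)]
  rw [← Finset.sum_mul, show ∑ j, w j = 0 from hw, zero_mul]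

/-! ### Uniqueness of Fisher–Rao geodesics -/

theorem sum_deriv_eq_zero {I : Set ℝ} (hI : IsOpen I) {q : ℝ → Fin n → ℝ} {k : ℝ}
    (hq : ∀ t ∈ I, ∑ j, q t j = k) {t : ℝ} (ht : t ∈ I) (hd : DifferentiableAt ℝ q t) :
    ∑ j, deriv q t j = 0 := by
  have h1 : HasDerivAt (fun s => ∑ j, q s j) (∑ j, deriv q t j) t :=
    HasDerivAt.fun_sum fun j _ => hasDerivAt_pi.1 hd.hasDerivAt j
  have h2 : HasDerivAt (fun s => ∑ j, q s j) 0 t :=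
    (hasDerivAt_const t k).congr_of_eventuallyEq
      (Filter.eventually_of_mem (hI.mem_nhds ht) hq)
  exact h1.unique h2

theorem eq_of_hasDerivAt_zero {I : Set ℝ} (hI : IsOpen I) (hI' : I.OrdConnected) {F : ℝ → ℝ}
    (hF : ∀ t ∈ I, HasDerivAt F 0 t) {s t : ℝ} (hs : s ∈ I) (ht : t ∈ I) : F s = F t :=
  hI.is_const_of_deriv_eq_zero hI'.isPreconnected
    (fun u hu => (hF u hu).differentiableAt.differentiableWithinAt)
    (fun u hu => (hF u hu).deriv) hs ht

/-- The equation `z'' = -k² z` with zero initial data has only the zero solution. -/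
theorem eq_zero_of_harmonic {I : Set ℝ} (hI : IsOpen I) (hI' : I.OrdConnected) (h0 : 0 ∈ I)
    {z v : ℝ → ℝ} {k : ℝ} (hz : ∀ t ∈ I, HasDerivAt z (v t) t)
    (hv : ∀ t ∈ I, HasDerivAt v (-k ^ 2 * z t) t) (z0 : z 0 = 0) (v0 : v 0 = 0) :
    ∀ t ∈ I, z t = 0 := by
  have hE : ∀ t ∈ I, v t ^ 2 + k ^ 2 * z t ^ 2 = 0 := by
    intro t ht
    have := eq_of_hasDerivAt_zero hI hI' (F := fun t => v t ^ 2 + k ^ 2 * z t ^ 2)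
      (fun s hs => (((hv s hs).pow 2).add (((hz s hs).pow 2).const_mul (k ^ 2))).congr_deriv
        (by simp; ring)) ht h0
    simpa [z0, v0] using this
  -- Since `k` may be zero, the vanishing energy only yields `v = 0`; `z` is then constant.
  have hv0 : ∀ t ∈ I, v t = 0 := fun t ht => by
    refine (pow_eq_zero_iff two_ne_zero).1 (le_antisymm ?_ (sq_nonneg (v t)))
    linarith [hE t ht, mul_nonneg (sq_nonneg k) (sq_nonneg (z t))]
  intro t ht
  rw [← z0]
  exact eq_of_hasDerivAt_zero hI hI' (fun s hs => (hz s hs).congr_deriv (hv0 s hs)) ht h0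

/-- A Fisher-Rao geodesic satisfies the geodesic equation with a multiplier fixed by its speed. -/
theorem IsGeodesicOn.multiplier {I : Set ℝ} (hI : IsOpen I) {q : ℝ → Fin n → ℝ}
    (hq : IsGeodesicOn (simplex n) (simplexTangent n) fisherRao I q) {t : ℝ} (ht : t ∈ I)
    (j : Fin n) :
    deriv (deriv q) t j / q t j - deriv q t j ^ 2 / (2 * q t j ^ 2)
      = -(fisherRao (q t) (deriv q t) (deriv q t) / 2) := by
  have hpos := (hq.1 t ht).1.1
  have hsum := (hq.1 t ht).1.2
  have hv : ∀ s ∈ I, ∑ i, deriv q s i = 0 := fun s hs =>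
    sum_deriv_eq_zero hI (fun u hu => (hq.1 u hu).1.2) hs (hq.1 s hs).2.1
  have hacc : ∑ i, deriv (deriv q) t i = 0 := sum_deriv_eq_zero hI hv ht (hq.1 t ht).2.2
  -- The vector `eⱼ - q` is tangent because `∑ q = 1`. Testing on it equates the bracket at `j` with
  -- its `q`-weighted mean, which `∑ q'' = 0` evaluates to minus half the squared speed.
  have h := (hq.2 t ht (Pi.single j 1 - q t) (by simp [simplexTangent, hsum])).2.2
  rw [fisherRao_add_christoffel (fun i => (hpos i).ne')] at h
  simp only [Pi.sub_apply, sub_mul, Finset.sum_sub_distrib, Pi.single_apply, ite_mul, one_mul,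
    zero_mul, Finset.sum_ite_eq', Finset.mem_univ, if_true] at h
  rw [sub_eq_zero.1 h]
  have h2 : ∀ i, q t i * (deriv (deriv q) t i / q t i - deriv q t i ^ 2 / (2 * q t i ^ 2))
      = deriv (deriv q) t i - deriv q t i * deriv q t i / q t i / 2 := fun i => by
    have := (hpos i).ne'
    field_simp
  simp only [h2, Finset.sum_sub_distrib, hacc, ← Finset.sum_div, fisherRao]
  ring

/-- The derivative of the squared speed is `∑ 2 q'ⱼ` times the bracket of `multiplier`. That bracket
is independent of `j`, and `∑ q' = 0`. -/
theorem IsGeodesicOn.speed_eq {I : Set ℝ} (hI : IsOpen I) (hI' : I.OrdConnected)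
    {q : ℝ → Fin n → ℝ} (hq : IsGeodesicOn (simplex n) (simplexTangent n) fisherRao I q)
    {s t : ℝ} (hs : s ∈ I) (ht : t ∈ I) :
    fisherRao (q s) (deriv q s) (deriv q s) = fisherRao (q t) (deriv q t) (deriv q t) := by
  refine eq_of_hasDerivAt_zero hI hI' (F := fun t => fisherRao (q t) (deriv q t) (deriv q t))
    (fun u hu => ?_) hs ht
  have hpos := (hq.1 u hu).1.1
  have h1 := hasDerivAt_pi.1 (hq.1 u hu).2.1.hasDerivAt
  have h2 := hasDerivAt_pi.1 (hq.1 u hu).2.2.hasDerivAt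
  have hv : ∑ i, deriv q u i = 0 :=
    sum_deriv_eq_zero hI (fun s hs => (hq.1 s hs).1.2) hu (hq.1 u hu).2.1
  refine (HasDerivAt.fun_sum fun j _ =>
    ((h2 j).mul (h2 j)).div (h1 j) (hpos j).ne').congr_deriv ?_
  calc _ = ∑ j, 2 * deriv q u j *
        (deriv (deriv q) u j / q u j - deriv q u j ^ 2 / (2 * q u j ^ 2)) := by
        refine Finset.sum_congr rfl fun j _ => ?_
        have := (hpos j).ne'
        simp only [Pi.mul_apply]
        field_simp
        ring
    _ = 0 := by
        simp only [hq.multiplier hI hu, ← Finset.sum_mul, ← Finset.mul_sum, hv]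
        simp

/-- With the multiplier constant, `√q` and `frAmp` solve the same linear oscillator with the same
initial data; their difference falls under `eq_zero_of_harmonic`. -/
theorem IsGeodesicOn.eq_frCurve {I : Set ℝ} (hI : IsOpen I) (hI' : I.OrdConnected) (h0 : 0 ∈ I)
    {q : ℝ → Fin n → ℝ} (hq : IsGeodesicOn (simplex n) (simplexTangent n) fisherRao I q)
    {p a : Fin n → ℝ} (q0 : q 0 = p) (q0' : deriv q 0 = a) :
    ∀ t ∈ I, q t = frCurve p a t := by
  have hp : ∀ j, 0 < p j := q0 ▸ (hq.1 0 h0).1.1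
  have hspeed : ∀ t ∈ I, fisherRao (q t) (deriv q t) (deriv q t) = frNorm p a ^ 2 := by
    intro t ht
    rw [hq.speed_eq hI hI' ht h0, q0, q0', frNorm_sq hp]
  have key : ∀ j, ∀ t ∈ I, √(q t j) - frAmp p a j t = 0 := by
    intro j
    refine eq_zero_of_harmonic hI hI' h0 (z := fun t => √(q t j) - frAmp p a j t)
      (v := fun t => deriv q t j / (2 * √(q t j)) - frAmpVel p a j t) (k := frNorm p a / 2)
      ?_ ?_ ?_ ?_
    · intro t ht
      have hpos := (hq.1 t ht).1.1
      exact ((hasDerivAt_pi.1 (hq.1 t ht).2.1.hasDerivAt j).sqrt (hpos j).ne').sub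
        (hasDerivAt_frAmp hp a j t)
    · intro t ht
      have hpos := (hq.1 t ht).1.1
      have hs : √(q t j) ≠ 0 := (Real.sqrt_pos.2 (hpos j)).ne'
      have h1 := (hasDerivAt_pi.1 (hq.1 t ht).2.1.hasDerivAt j).sqrt (hpos j).ne'
      have h2 := hasDerivAt_pi.1 (hq.1 t ht).2.2.hasDerivAt j
      refine ((h2.div (h1.const_mul 2) (by simpa using hs)).sub
        (hasDerivAt_frAmpVel p a j t)).congr_deriv ?_
      have hm := hq.multiplier hI ht j
      rw [hspeed t ht] at hm
      have hsq : q t j = √(q t j) ^ 2 := (Real.sq_sqrt (hpos j).le).symm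
      have hacc : deriv (deriv q) t j =
          q t j * (deriv q t j ^ 2 / (2 * q t j ^ 2) - frNorm p a ^ 2 / 2) := by
        have := (hpos j).ne'
        field_simp at hm ⊢
        linear_combination hm
      rw [hacc]
      generalize √(q t j) = y at *
      rw [hsq]
      field_simp
      ring
    · simp [q0, frAmp]
    · simp only [q0, q0', frAmpVel]
      simp
      field_simp
      simp
  intro t ht
  funext j
  rw [frCurve_eq_sq hp, ← sub_eq_zero.1 (key j t ht), Real.sq_sqrt ((hq.1 t ht).1.1 j).le]

end FisherRao

/-! ### Functional calculus on eigenvectors -/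

section FunctionalCalculus

variable {m : Type*} [Fintype m] [DecidableEq m]

theorem aeval_mulVec_of_eigenvector {M : Matrix m m ℂ} {v : m → ℂ} {μ : ℝ}
    (h : M.mulVec v = (μ : ℂ) • v) (q : Polynomial ℝ) :
    (Polynomial.aeval M q).mulVec v = ((q.eval μ : ℝ) : ℂ) • v := by
  have hpow : ∀ k : ℕ, (M ^ k).mulVec v = ((μ ^ k : ℝ) : ℂ) • v := by
    intro k
    induction k with
    | zero => simp
    | succ k ih =>
      rw [pow_succ, ← Matrix.mulVec_mulVec, h, Matrix.mulVec_smul, ih, smul_smul]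
      congr 1
      push_cast
      ring
  induction q using Polynomial.induction_on' with
  | add p q hp hq => simp [Matrix.add_mulVec, hp, hq, add_smul]
  | monomial k r =>
    rw [Polynomial.aeval_monomial, ← Matrix.mulVec_mulVec, hpow, Matrix.mulVec_smul,
      Matrix.algebraMap_eq_diagonal]
    ext i
    simp [Matrix.mulVec_diagonal]
    ring

/-- The functional calculus acts on an eigenvector through the value at the eigenvalue. -/
theorem cfc_mulVec_of_eigenvector {M : Matrix m m ℂ} (hM : M.IsHermitian) (f : ℝ → ℝ)
    {v : m → ℂ} {μ : ℝ} (h : M.mulVec v = (μ : ℂ) • v) :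
    (cfc f M).mulVec v = ((f μ : ℝ) : ℂ) • v := by
  classical
  have hfin : (spectrum ℝ M).Finite := by
    rw [hM.spectrum_real_eq_range_eigenvalues]; exact Set.finite_range _
  -- Interpolating on the finite spectrum replaces `f` by a polynomial. Adding `μ` as a node covers
  -- `v = 0`, where `μ` need not be in the spectrum.
  set S : Finset ℝ := insert μ hfin.toFinset with hS
  set q : Polynomial ℝ := Lagrange.interpolate S id f with hq
  have hqf : ∀ x ∈ S, q.eval x = f x := fun x hx =>
    Lagrange.eval_interpolate_at_node (v := id) f (Set.injOn_id _) hx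
  have h1 : cfc f M = cfc q.eval M := by
    refine cfc_congr fun x hx => (hqf x ?_).symm
    simp [hS, hx]
  rw [h1, cfc_polynomial q M hM.isSelfAdjoint, aeval_mulVec_of_eigenvector h, hqf μ (by simp [hS])]

end FunctionalCalculus

/-! ### Two-by-two test matrices for operator monotonicity -/

section PlaneMatrices

/-- The real symmetric matrix with eigenvalues `α`, `δ` and eigenvectors `(c, s)`, `(-s, c)`, when
`c² + s² = 1`. -/
def planeMatrix (c s α δ : ℝ) : Matrix (Fin 2) (Fin 2) ℂ :=
  !![((α * c ^ 2 + δ * s ^ 2 : ℝ) : ℂ), (((α - δ) * c * s : ℝ) : ℂ);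
    (((α - δ) * c * s : ℝ) : ℂ), ((α * s ^ 2 + δ * c ^ 2 : ℝ) : ℂ)]

/-- The quadratic form of `planeMatrix`. -/
def planeForm (c s α δ x y : ℝ) : ℝ := α * (c * x + s * y) ^ 2 + δ * (c * y - s * x) ^ 2

theorem planeMatrix_isHermitian (c s α δ : ℝ) : (planeMatrix c s α δ).IsHermitian := by
  ext i j
  fin_cases i <;> fin_cases j <;> simp [planeMatrix, -Complex.ofReal_add, -Complex.ofReal_mul,
    -Complex.ofReal_sub, -Complex.ofReal_pow]

/-- The matrix is real symmetric, so real and imaginary parts decouple and the Loewner order reduces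
to inequalities between real forms. -/
theorem dotProduct_planeMatrix (c s α δ : ℝ) (z : Fin 2 → ℂ) :
    star z ⬝ᵥ (planeMatrix c s α δ).mulVec z =
      ((planeForm c s α δ (z 0).re (z 1).re + planeForm c s α δ (z 0).im (z 1).im : ℝ) : ℂ) := by
  simp only [planeMatrix, planeForm, dotProduct, Fin.sum_univ_two, Matrix.mulVec, Pi.star_apply]
  apply Complex.ext <;> simp [-Complex.ofReal_add, -Complex.ofReal_mul,
    -Complex.ofReal_sub, -Complex.ofReal_pow] <;> ring

theorem planeMatrix_posDef {c s α δ : ℝ} (h : c ^ 2 + s ^ 2 = 1) (hα : 0 < α) (hδ : 0 < δ) :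
    (planeMatrix c s α δ).PosDef := by
  refine Matrix.PosDef.of_dotProduct_mulVec_pos (planeMatrix_isHermitian _ _ _ _) fun z hz => ?_
  rw [dotProduct_planeMatrix, Complex.zero_lt_real]
  have key : ∀ x y : ℝ, 0 ≤ planeForm c s α δ x y ∧
      (planeForm c s α δ x y = 0 → x = 0 ∧ y = 0) := by
    intro x y
    refine ⟨by unfold planeForm; positivity, fun h0 => ?_⟩
    have h1 : (c * x + s * y) ^ 2 = 0 := by
      unfold planeForm at h0
      nlinarith [mul_nonneg hα.le (sq_nonneg (c * x + s * y)),
        mul_nonneg hδ.le (sq_nonneg (c * y - s * x)), sq_nonneg (c * x + s * y)]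
    have h2 : (c * y - s * x) ^ 2 = 0 := by
      unfold planeForm at h0
      nlinarith [mul_nonneg hα.le (sq_nonneg (c * x + s * y)),
        mul_nonneg hδ.le (sq_nonneg (c * y - s * x)), sq_nonneg (c * y - s * x)]
    have h3 := pow_eq_zero_iff (two_ne_zero) |>.1 h1
    have h4 := pow_eq_zero_iff (two_ne_zero) |>.1 h2
    constructor
    · linear_combination c * h3 - s * h4 - x * h
    · linear_combination s * h3 + c * h4 - y * h
  obtain ⟨h1, h1'⟩ := key (z 0).re (z 1).re
  obtain ⟨h2, h2'⟩ := key (z 0).im (z 1).im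
  refine lt_of_le_of_ne (by positivity) fun h0 => hz ?_
  obtain ⟨h3, h4⟩ := h1' (by linarith)
  obtain ⟨h5, h6⟩ := h2' (by linarith)
  funext i
  fin_cases i
  · exact Complex.ext h3 h5
  · exact Complex.ext h4 h6

theorem planeMatrix_sub_posSemidef_iff {c s α δ c' s' α' δ' : ℝ} :
    (planeMatrix c' s' α' δ' - planeMatrix c s α δ).PosSemidef ↔
      ∀ x y, planeForm c s α δ x y ≤ planeForm c' s' α' δ' x y := by
  rw [Matrix.posSemidef_iff_dotProduct_mulVec]
  simp only [Matrix.sub_mulVec, dotProduct_sub, dotProduct_planeMatrix, ← Complex.ofReal_sub,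
    Complex.zero_le_real]
  constructor
  · rintro ⟨-, h⟩ x y
    simpa [planeForm] using h ![(x : ℂ), (y : ℂ)]
  · intro h
    refine ⟨(planeMatrix_isHermitian _ _ _ _).sub (planeMatrix_isHermitian _ _ _ _), fun z => ?_⟩
    linarith [h (z 0).re (z 1).re, h (z 0).im (z 1).im]

theorem planeMatrix_mulVec_fst {c s : ℝ} (h : c ^ 2 + s ^ 2 = 1) (α δ : ℝ) :
    (planeMatrix c s α δ).mulVec ![(c : ℂ), (s : ℂ)] = (α : ℂ) • ![(c : ℂ), (s : ℂ)] := by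
  have h' : (c : ℂ) ^ 2 + (s : ℂ) ^ 2 = 1 := by exact_mod_cast h
  ext i
  fin_cases i
  · simp [planeMatrix]
    linear_combination (α : ℂ) * c * h'
  · simp [planeMatrix]
    linear_combination (α : ℂ) * s * h'

theorem planeMatrix_mulVec_snd {c s : ℝ} (h : c ^ 2 + s ^ 2 = 1) (α δ : ℝ) :
    (planeMatrix c s α δ).mulVec ![-(s : ℂ), (c : ℂ)] = (δ : ℂ) • ![-(s : ℂ), (c : ℂ)] := by
  have h' : (c : ℂ) ^ 2 + (s : ℂ) ^ 2 = 1 := by exact_mod_cast h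
  ext i
  fin_cases i
  · simp [planeMatrix]
    linear_combination -(δ : ℂ) * s * h'
  · simp [planeMatrix]
    linear_combination (δ : ℂ) * c * h'

theorem cfc_planeMatrix {c s : ℝ} (h : c ^ 2 + s ^ 2 = 1) (α δ : ℝ) (f : ℝ → ℝ) :
    cfc f (planeMatrix c s α δ) = planeMatrix c s (f α) (f δ) := by
  have h1 := (cfc_mulVec_of_eigenvector (planeMatrix_isHermitian c s α δ) f
    (planeMatrix_mulVec_fst h α δ)).trans (planeMatrix_mulVec_fst h (f α) (f δ)).symm
  have h2 := (cfc_mulVec_of_eigenvector (planeMatrix_isHermitian c s α δ) f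
    (planeMatrix_mulVec_snd h α δ)).trans (planeMatrix_mulVec_snd h (f α) (f δ)).symm
  have h' : (c : ℂ) ^ 2 + (s : ℂ) ^ 2 = 1 := by exact_mod_cast h
  generalize cfc f (planeMatrix c s α δ) = A at *
  generalize planeMatrix c s (f α) (f δ) = B at *
  ext i j
  have h3 := congrFun h1 i
  have h4 := congrFun h2 i
  simp [Matrix.mulVec, dotProduct] at h3 h4
  fin_cases j
  · simp only [Fin.zero_eta]
    linear_combination c * h3 - s * h4 - (A i 0 - B i 0) * h'
  · simp only [Fin.mk_one]
    linear_combination s * h3 + c * h4 - (A i 1 - B i 1) * h'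

/-- This is `diag(a, b)` in the orthonormal frame `(c, s)`, `(-s, c)`. -/
theorem planeForm_rotate {c s : ℝ} (h : c ^ 2 + s ^ 2 = 1) (a b u v : ℝ) :
    planeForm 1 0 a b u v = (c ^ 2 * a + s ^ 2 * b) * (c * u + s * v) ^ 2
      + 2 * ((b - a) * c * s) * (c * u + s * v) * (c * v - s * u)
      + (s ^ 2 * a + c ^ 2 * b) * (c * v - s * u) ^ 2 := by
  have hu : u = c * (c * u + s * v) - s * (c * v - s * u) := by linear_combination -u * h
  have hv : v = s * (c * u + s * v) + c * (c * v - s * u) := by linear_combination -v * h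
  generalize c * u + s * v = X at *
  generalize c * v - s * u = Y at *
  rw [hu, hv, planeForm]
  ring

theorem OperatorMonotone.planeForm_le {f : ℝ → ℝ} (hf : OperatorMonotone f)
    {c s α δ c' s' α' δ' : ℝ} (h : c ^ 2 + s ^ 2 = 1) (h' : c' ^ 2 + s' ^ 2 = 1) (hα : 0 < α)
    (hδ : 0 < δ) (hα' : 0 < α') (hδ' : 0 < δ')
    (hle : ∀ x y, planeForm c s α δ x y ≤ planeForm c' s' α' δ' x y) (x y : ℝ) :
    planeForm c s (f α) (f δ) x y ≤ planeForm c' s' (f α') (f δ') x y := by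
  have := hf 2 _ _ (planeMatrix_posDef h hα hδ) (planeMatrix_posDef h' hα' hδ')
    (planeMatrix_sub_posSemidef_iff.2 hle)
  rw [cfc_planeMatrix h, cfc_planeMatrix h'] at this
  exact planeMatrix_sub_posSemidef_iff.1 this x y

end PlaneMatrices

/-! ### Bounds by the harmonic and arithmetic means -/

namespace IsPetzFunction

variable {f : ℝ → ℝ}

theorem monotone (hf : IsPetzFunction f) {x y : ℝ} (hx : 0 < x) (hxy : x ≤ y) : f x ≤ f y := by
  have := hf.operatorMonotone.planeForm_le (c := 1) (s := 0) (c' := 1) (s' := 0) (by norm_num)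
    (by norm_num) hx hx (hx.trans_le hxy) (hx.trans_le hxy)
    (fun u v => by simp only [planeForm]; nlinarith [sq_nonneg u, sq_nonneg v]) 1 0
  simpa [planeForm] using this

theorem le_self (hf : IsPetzFunction f) {x : ℝ} (hx : 1 ≤ x) : f x ≤ x := by
  have hx0 : 0 < x := by linarith
  rw [hf.symm x hx0]
  have := hf.monotone (inv_pos.2 hx0) (inv_le_one_of_one_le₀ hx)
  rw [hf.map_one] at this
  nlinarith

theorem self_le (hf : IsPetzFunction f) {x : ℝ} (hx0 : 0 < x) (hx : x ≤ 1) : x ≤ f x := by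
  rw [hf.symm x hx0]
  have := hf.monotone one_pos ((one_le_inv₀ hx0).2 hx)
  rw [hf.map_one] at this
  nlinarith

theorem map_inv (hf : IsPetzFunction f) {x : ℝ} (hx : 0 < x) : f x⁻¹ = f x / x := by
  rw [hf.symm x hx]; field_simp

/-- The arithmetic mean dominates every symmetric operator monotone mean. -/
theorem le_arithmetic (hf : IsPetzFunction f) {x : ℝ} (hx : 0 < x) : f x ≤ (1 + x) / 2 := by
  have hfx := hf.pos x hx
  have key : ∀ ε > 0, 2 * f x / (1 + x) ≤ 1 + ε := by
    intro ε hε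
    -- The unit vector `e = (c, s)` is chosen so that `diag(x, x⁻¹)` has mean value `1` in it, while
    -- `diag(f x, f x⁻¹)` has mean value `2 f x / (1 + x)` by symmetry.
    set c := √(1 / (1 + x)) with hc
    set s := √(x / (1 + x)) with hs
    have hc2 : c ^ 2 = 1 / (1 + x) := Real.sq_sqrt (by positivity)
    have hs2 : s ^ 2 = x / (1 + x) := Real.sq_sqrt (by positivity)
    have hcs : c ^ 2 + s ^ 2 = 1 := by rw [hc2, hs2]; field_simp
    have hp : c ^ 2 * x + s ^ 2 * x⁻¹ = 1 := by rw [hc2, hs2]; field_simp; ring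
    set β := (x⁻¹ - x) * c * s with hβ
    set q := s ^ 2 * x + c ^ 2 * x⁻¹ with hq
    have hq0 : 0 < q := by rw [hq, hc2, hs2]; positivity
    -- The majorant is diagonal in the frame of `e`. Its second eigenvalue absorbs the off-diagonal
    -- entry `β` at the cost of `ε`, making the gap a perfect square. The images under `f` are
    -- compared at `e`.
    have h := hf.operatorMonotone.planeForm_le (c := 1) (s := 0) (c' := c) (s' := s)
      (α' := 1 + ε) (δ' := q + β ^ 2 / ε) (by norm_num) hcs hx (inv_pos.2 hx) (by positivity)
      (by positivity) (fun u v => by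
        have h1 : planeForm c s (1 + ε) (q + β ^ 2 / ε) u v - planeForm 1 0 x x⁻¹ u v
            = (ε * (c * u + s * v) - β * (c * v - s * u)) ^ 2 / ε := by
          have h2 := planeForm_rotate hcs x x⁻¹ u v
          rw [hp, ← hβ, ← hq] at h2
          rw [h2]
          simp only [planeForm]
          field_simp
          ring
        have h3 : 0 ≤ (ε * (c * u + s * v) - β * (c * v - s * u)) ^ 2 / ε := by positivity
        linarith) c s
    have h4 : planeForm 1 0 (f x) (f x⁻¹) c s = 2 * f x / (1 + x) := by
      simp only [planeForm, hf.map_inv hx]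
      ring_nf
      rw [hc2, hs2]
      field_simp
      ring
    have h5 : planeForm c s (f (1 + ε)) (f (q + β ^ 2 / ε)) c s = f (1 + ε) := by
      have : c * c + s * s = 1 := by linear_combination hcs
      simp only [planeForm, this]
      ring
    rw [h4, h5] at h
    exact h.trans (hf.le_self (by linarith))
  have := le_of_forall_pos_le_add key
  rw [div_le_one (by positivity)] at this
  linarith

/-- The harmonic mean is dominated by every symmetric operator monotone mean. -/
theorem harmonic_le (hf : IsPetzFunction f) {x : ℝ} (hx : 0 < x) : 2 * x / (1 + x) ≤ f x := by
  have hfx := hf.pos x hx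
  set T := 2 * x / (1 + x) / f x with hT
  have hT0 : 0 < T := by positivity
  have key : ∀ ε > 0, ε < 1 → (1 - ε) * T ≤ 1 := by
    intro ε hε hε1
    -- Here `e = (c, s)` is a unit vector in which the inverse of `diag(x, x⁻¹)` has mean value `1`,
    -- so `1 - ε` fits below as eigenvalue along `e`, with a small positive eigenvalue across.
    set c := √(x / (1 + x)) with hc
    set s := √(1 / (1 + x)) with hs
    have hc2 : c ^ 2 = x / (1 + x) := Real.sq_sqrt (by positivity)
    have hs2 : s ^ 2 = 1 / (1 + x) := Real.sq_sqrt (by positivity)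
    have hcs : c ^ 2 + s ^ 2 = 1 := by rw [hc2, hs2]; field_simp; ring
    have hq : s ^ 2 * x + c ^ 2 * x⁻¹ = 1 := by rw [hc2, hs2]; field_simp; ring
    set β := (x⁻¹ - x) * c * s with hβ
    have hp : c ^ 2 * x + s ^ 2 * x⁻¹ = 1 + β ^ 2 := by
      have : β ^ 2 = (x⁻¹ - x) ^ 2 * c ^ 2 * s ^ 2 := by rw [hβ]; ring
      rw [this, hc2, hs2]; field_simp; ring
    have hr : 0 < β ^ 2 + ε := by positivity
    -- The test vector is `diag(f x, f x⁻¹)⁻¹ e`: its pairing with `e` and its value in the larger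
    -- form are both `T`, whence `f (1 - ε) T² ≤ T`.
    have h := hf.operatorMonotone.planeForm_le (c := c) (s := s) (c' := 1) (s' := 0)
      (α := 1 - ε) (δ := ε / (β ^ 2 + ε)) hcs (by norm_num) (by linarith) (by positivity)
      hx (inv_pos.2 hx) (fun u v => by
        have h1 : planeForm 1 0 x x⁻¹ u v - planeForm c s (1 - ε) (ε / (β ^ 2 + ε)) u v
            = ((β ^ 2 + ε) * (c * u + s * v) + β * (c * v - s * u)) ^ 2 / (β ^ 2 + ε) := by
          have h2 := planeForm_rotate hcs x x⁻¹ u v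
          rw [hp, ← hβ, hq] at h2
          rw [h2]
          simp only [planeForm]
          field_simp
          ring
        have h3 : 0 ≤ ((β ^ 2 + ε) * (c * u + s * v) + β * (c * v - s * u)) ^ 2 / (β ^ 2 + ε) := by
          positivity
        linarith) (c / f x) (s / f x⁻¹)
    have h4 : planeForm 1 0 (f x) (f x⁻¹) (c / f x) (s / f x⁻¹) = T := by
      simp only [planeForm, hf.map_inv hx, hT]
      have : (f x) * (1 * (c / f x) + 0 * (s / (f x / x))) ^ 2
          + f x / x * (1 * (s / (f x / x)) - 0 * (c / f x)) ^ 2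
          = (c ^ 2 + x * s ^ 2) / f x := by field_simp; ring
      rw [this, hc2, hs2]
      field_simp
      ring
    have h5 : c * (c / f x) + s * (s / f x⁻¹) = T := by
      have : c * (c / f x) + s * (s / f x⁻¹) = (c ^ 2 + x * s ^ 2) / f x := by
        rw [hf.map_inv hx]; field_simp
      rw [this, hc2, hs2, hT]
      field_simp
      ring
    have h6 : (1 - ε) * T ^ 2 ≤ T := by
      rw [h4] at h
      simp only [planeForm, h5] at h
      have h7 : 0 ≤ f (ε / (β ^ 2 + ε)) * (c * (s / f x⁻¹) - s * (c / f x)) ^ 2 :=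
        mul_nonneg (hf.pos _ (by positivity)).le (sq_nonneg _)
      have h8 := mul_le_mul_of_nonneg_right (hf.self_le (x := 1 - ε) (by linarith) (by linarith))
        (sq_nonneg T)
      linarith
    have h9 : (1 - ε) * T * T ≤ 1 * T := by linarith
    exact le_of_mul_le_mul_right h9 hT0
  have hT1 : T ≤ 1 := by
    by_contra! hcon
    have := key ((T - 1) / (2 * T)) (by apply div_pos <;> linarith)
      (by rw [div_lt_one (by linarith)]; linarith)
    have h2 : (1 - (T - 1) / (2 * T)) * T = (T + 1) / 2 := by field_simp; ring
    linarith
  rw [hT, div_le_one hfx] at hT1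
  exact hT1

end IsPetzFunction

/-! ### Monotone metrics in an eigenbasis of the state -/

section MonotoneMetric

open Matrix Unitary

variable {n : ℕ}

theorem stdBasis_repr_apply (M : Matrix (Fin n) (Fin n) ℂ) (i j : Fin n) :
    (Matrix.stdBasis ℂ (Fin n) (Fin n)).repr M (i, j) = M i j := by
  have h := congrFun (congrFun ((Matrix.stdBasis ℂ (Fin n) (Fin n)).sum_repr M) i) j
  rw [← h, Fintype.sum_prod_type, Matrix.sum_apply, Finset.sum_eq_single i, Matrix.sum_apply,
    Finset.sum_eq_single j]
  · simp [Matrix.stdBasis_eq_single]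
  · intro b _ hb
    simp [Matrix.stdBasis_eq_single, hb]
  · simp
  · intro b _ hb
    rw [Matrix.sum_apply]
    exact Finset.sum_eq_zero fun c _ => by simp [Matrix.stdBasis_eq_single, hb]
  · simp

theorem superFun_apply_of_eigenvector {Φ : SuperOp n} (hΦ : (LinearMap.toMatrix
      (Matrix.stdBasis ℂ (Fin n) (Fin n)) (Matrix.stdBasis ℂ (Fin n) (Fin n)) Φ).IsHermitian)
    (f : ℝ → ℝ) {x : Matrix (Fin n) (Fin n) ℂ} {μ : ℝ} (h : Φ x = (μ : ℂ) • x) :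
    superFun f Φ x = ((f μ : ℝ) : ℂ) • x := by
  apply (Matrix.stdBasis ℂ (Fin n) (Fin n)).repr.injective
  apply DFunLike.coe_injective
  rw [superFun, Matrix.repr_toLin, cfc_mulVec_of_eigenvector hΦ f (μ := μ)]
  · rw [map_smul, Finsupp.coe_smul]
  · rw [LinearMap.toMatrix_mulVec_repr, h, map_smul, Finsupp.coe_smul]

/-- Self-adjointness is what makes the `cfc` inside `superFun` a genuine functional calculus. -/
theorem toMatrix_mulLeft_mulRight_isHermitian {A B : Matrix (Fin n) (Fin n) ℂ}
    (hA : A.IsHermitian) (hB : B.IsHermitian) : (LinearMap.toMatrix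
      (Matrix.stdBasis ℂ (Fin n) (Fin n)) (Matrix.stdBasis ℂ (Fin n) (Fin n))
      (LinearMap.mulLeft ℂ A ∘ₗ LinearMap.mulRight ℂ B)).IsHermitian := by
  have key : ∀ i j k l, LinearMap.toMatrix
      (Matrix.stdBasis ℂ (Fin n) (Fin n)) (Matrix.stdBasis ℂ (Fin n) (Fin n))
      (LinearMap.mulLeft ℂ A ∘ₗ LinearMap.mulRight ℂ B) (i, j) (k, l) = A i k * B l j := by
    intro i j k l
    rw [LinearMap.toMatrix_apply, stdBasis_repr_apply, Matrix.stdBasis_eq_single]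
    simp only [LinearMap.comp_apply, LinearMap.mulLeft_apply, LinearMap.mulRight_apply]
    rw [Matrix.mul_apply, Finset.sum_eq_single k]
    · simp
    · intro b _ hb
      simp [hb]
    · simp
  ext ⟨i, j⟩ ⟨k, l⟩
  rw [Matrix.conjTranspose_apply, key, key, star_mul', hA.apply, hB.apply]

/-- The coefficients of `K_ρ` in an eigenbasis of `ρ`. -/
def petzCoeff (f : ℝ → ℝ) (p : Fin n → ℝ) (i j : Fin n) : ℝ := p j * f (p i / p j)

/-- The diagonal matrix with real entries `p`, as a complex matrix. -/
def realDiag (p : Fin n → ℝ) : Matrix (Fin n) (Fin n) ℂ := Matrix.diagonal fun j => (p j : ℂ)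

theorem realDiag_mul (p q : Fin n → ℝ) : realDiag p * realDiag q = realDiag (p * q) := by
  simp [realDiag, Matrix.diagonal_mul_diagonal]

theorem realDiag_one : realDiag (1 : Fin n → ℝ) = 1 := by
  simp [realDiag]

theorem realDiag_isHermitian (p : Fin n → ℝ) : (realDiag p).IsHermitian := by
  ext i j
  by_cases h : i = j
  · subst h; simp [realDiag]
  · simp [realDiag, h, Ne.symm h]

variable (U : unitary (Matrix (Fin n) (Fin n) ℂ))

theorem trace_conj (M : Matrix (Fin n) (Fin n) ℂ) :
    (conjStarAlgAut ℂ _ U M).trace = M.trace := by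
  rw [conjStarAlgAut_apply, Matrix.trace_mul_cycle]
  simp

theorem isHermitian_conj_iff {M : Matrix (Fin n) (Fin n) ℂ} :
    (conjStarAlgAut ℂ _ U M).IsHermitian ↔ M.IsHermitian := by
  rw [Matrix.IsHermitian, Matrix.IsHermitian, ← Matrix.star_eq_conjTranspose,
    ← Matrix.star_eq_conjTranspose, ← map_star]
  exact (conjStarAlgAut ℂ _ U).injective.eq_iff

theorem inv_conj_realDiag {p : Fin n → ℝ} (hp : ∀ j, p j ≠ 0) :
    (conjStarAlgAut ℂ _ U (realDiag p))⁻¹ = conjStarAlgAut ℂ _ U (realDiag p⁻¹) := by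
  apply Matrix.inv_eq_right_inv
  have : p * p⁻¹ = 1 := by ext j; simp [hp j]
  rw [← map_mul, realDiag_mul, this, realDiag_one, map_one]

/-- Conjugated matrix units are joint eigenvectors: of `L_ρ R_{ρ⁻¹}` with eigenvalue `p i / p j`,
and of `R_ρ` with eigenvalue `p j`. -/
theorem petzK_conj {f : ℝ → ℝ} {p : Fin n → ℝ} (hp : ∀ j, 0 < p j)
    (M : Matrix (Fin n) (Fin n) ℂ) :
    petzK f (conjStarAlgAut ℂ _ U (realDiag p)) (conjStarAlgAut ℂ _ U M)
      = conjStarAlgAut ℂ _ U (Matrix.of fun i j => (petzCoeff f p i j : ℂ) * M i j) := by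
  set φ := conjStarAlgAut ℂ (Matrix (Fin n) (Fin n) ℂ) U with hφ
  have hsingle : ∀ i j (z : ℂ), petzK f (φ (realDiag p)) (φ (Matrix.single i j z))
      = φ (Matrix.single i j ((petzCoeff f p i j : ℂ) * z)) := by
    intro i j z
    have hR : ∀ q : Fin n → ℝ, φ (Matrix.single i j z) * φ (realDiag q)
        = (q j : ℂ) • φ (Matrix.single i j z) := fun q => by
      rw [← map_mul, ← map_smul, realDiag]
      congr 1
      ext k l
      by_cases h1 : i = k <;> by_cases h2 : j = l <;>
        simp [Matrix.mul_diagonal, Matrix.single, h1, h2, mul_comm]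
    have hL : ∀ q : Fin n → ℝ, φ (realDiag q) * φ (Matrix.single i j z)
        = (q i : ℂ) • φ (Matrix.single i j z) := fun q => by
      rw [← map_mul, ← map_smul, realDiag]
      congr 1
      ext k l
      by_cases h1 : i = k <;> by_cases h2 : j = l <;>
        simp [Matrix.diagonal_mul, Matrix.single, h1, h2]
    have hinv := inv_conj_realDiag U (fun j => (hp j).ne')
    rw [← hφ] at hinv
    simp only [petzK, LinearMap.comp_apply, LinearMap.mulRight_apply]
    rw [hR, map_smul, superFun_apply_of_eigenvector (μ := p i / p j)]
    · rw [smul_smul, ← map_smul, Matrix.smul_single, petzCoeff]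
      simp
    · apply toMatrix_mulLeft_mulRight_isHermitian
      · exact (isHermitian_conj_iff U).2 (realDiag_isHermitian p)
      · rw [hinv]
        exact (isHermitian_conj_iff U).2 (realDiag_isHermitian _)
    · simp only [LinearMap.comp_apply, LinearMap.mulRight_apply, LinearMap.mulLeft_apply]
      rw [hinv, hR, mul_smul_comm, hL, smul_smul]
      congr 1
      simp
      ring
  conv_lhs => rw [Matrix.matrix_eq_sum_single M]
  conv_rhs => rw [Matrix.matrix_eq_sum_single (Matrix.of _)]
  simp only [map_sum, hsingle, Matrix.of_apply]

theorem petzCoeff_pos {f : ℝ → ℝ} (hf : ∀ x, 0 < x → 0 < f x) {p : Fin n → ℝ}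
    (hp : ∀ j, 0 < p j) (i j : Fin n) : 0 < petzCoeff f p i j :=
  mul_pos (hp j) (hf _ (div_pos (hp i) (hp j)))

theorem isUnit_petzK_conj {f : ℝ → ℝ} (hf : ∀ x, 0 < x → 0 < f x) {p : Fin n → ℝ}
    (hp : ∀ j, 0 < p j) : IsUnit (petzK f (conjStarAlgAut ℂ _ U (realDiag p))) := by
  rw [LinearMap.isUnit_iff_ker_eq_bot, LinearMap.ker_eq_bot']
  intro x hx
  obtain ⟨M, rfl⟩ := EquivLike.surjective (conjStarAlgAut ℂ _ U) x
  rw [petzK_conj U hp] at hx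
  have h := (map_eq_zero_iff _ (conjStarAlgAut ℂ _ U).injective).1 hx
  suffices M = 0 by rw [this, map_zero]
  ext i j
  have h2 := congrFun (congrFun h i) j
  simpa [(petzCoeff_pos hf hp i j).ne'] using h2

theorem monotoneMetric_conj {f : ℝ → ℝ} (hf : ∀ x, 0 < x → 0 < f x) {p : Fin n → ℝ}
    (hp : ∀ j, 0 < p j) (V W : Matrix (Fin n) (Fin n) ℂ) :
    monotoneMetric f (conjStarAlgAut ℂ _ U (realDiag p)) (conjStarAlgAut ℂ _ U V)
      (conjStarAlgAut ℂ _ U W) = ∑ i, ∑ j, (star (V i j) * W i j).re / petzCoeff f p i j := by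
  set φ := conjStarAlgAut ℂ (Matrix (Fin n) (Fin n) ℂ) U with hφ
  have h1 : Ring.inverse (petzK f (φ (realDiag p))) (φ W)
      = φ (Matrix.of fun i j => W i j / (petzCoeff f p i j : ℂ)) := by
    have h2 : φ W = petzK f (φ (realDiag p))
        (φ (Matrix.of fun i j => W i j / (petzCoeff f p i j : ℂ))) := by
      rw [hφ, petzK_conj U hp]
      congr 1
      ext i j
      have : (petzCoeff f p i j : ℂ) ≠ 0 := by exact_mod_cast (petzCoeff_pos hf hp i j).ne'
      simp only [Matrix.of_apply]
      field_simp
    rw [h2, ← Module.End.mul_apply, Ring.inverse_mul_cancel _ (isUnit_petzK_conj U hf hp)]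
    rfl
  rw [monotoneMetric, h1, ← Matrix.star_eq_conjTranspose, ← map_star, ← map_mul, hφ, trace_conj]
  simp only [Matrix.trace, Matrix.diag, Matrix.mul_apply, Complex.re_sum, Matrix.star_apply,
    Matrix.of_apply]
  rw [Finset.sum_comm]
  refine Finset.sum_congr rfl fun i _ => Finset.sum_congr rfl fun j _ => ?_
  rw [← mul_div_assoc, Complex.div_ofReal_re]

end MonotoneMetric

/-! ### First-order behaviour of the metric, trapped between two explicit functions -/

section Sandwich

open Matrix Unitary Filter Topology

variable {n : ℕ}

theorem exists_conj_realDiag {ρ : Matrix (Fin n) (Fin n) ℂ} (h : ρ.IsHermitian) :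
    ∃ (U : unitary (Matrix (Fin n) (Fin n) ℂ)) (p : Fin n → ℝ),
      ρ = conjStarAlgAut ℂ _ U (realDiag p) :=
  ⟨h.eigenvectorUnitary, h.eigenvalues, h.spectral_theorem⟩

theorem posDef_conj_realDiag_iff {U : unitary (Matrix (Fin n) (Fin n) ℂ)} {p : Fin n → ℝ} :
    (conjStarAlgAut ℂ _ U (realDiag p)).PosDef ↔ ∀ j, 0 < p j := by
  rw [conjStarAlgAut_apply, Matrix.IsUnit.posDef_star_right_conjugate_iff
    (Unitary.isUnit_coe), realDiag, Matrix.posDef_diagonal_iff]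
  simp

/-- Since `|X i j|` is symmetric in the indices, the weight `q j` may be averaged with `q i`; this
is how the arithmetic mean appears. -/
theorem re_trace_mul_realDiag_mul {X : Matrix (Fin n) (Fin n) ℂ} (hX : X.IsHermitian)
    (q : Fin n → ℝ) : (X * realDiag q * X).trace.re
      = ∑ i, ∑ j, Complex.normSq (X i j) * ((q i + q j) / 2) := by
  have h1 : (X * realDiag q * X).trace.re = ∑ i, ∑ j, Complex.normSq (X i j) * q j := by
    simp only [Matrix.trace, Matrix.diag, Complex.re_sum]
    refine Finset.sum_congr rfl fun i _ => ?_
    rw [Matrix.mul_apply, Complex.re_sum]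
    refine Finset.sum_congr rfl fun j _ => ?_
    rw [realDiag, Matrix.mul_diagonal, ← hX.apply j i, Complex.normSq_apply]
    simp
    ring
  have h2 : ∑ i, ∑ j, Complex.normSq (X i j) * q j = ∑ i, ∑ j, Complex.normSq (X i j) * q i := by
    rw [Finset.sum_comm]
    refine Finset.sum_congr rfl fun i _ => Finset.sum_congr rfl fun j _ => ?_
    rw [← hX.apply j i]
    simp
  rw [h1]
  have h3 : ∑ i, ∑ j, Complex.normSq (X i j) * ((q i + q j) / 2)
      = (∑ i, ∑ j, Complex.normSq (X i j) * q i) / 2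
        + (∑ i, ∑ j, Complex.normSq (X i j) * q j) / 2 := by
    simp only [Finset.sum_div, ← Finset.sum_add_distrib]
    refine Finset.sum_congr rfl fun i _ => Finset.sum_congr rfl fun j _ => ?_
    ring
  rw [h3, ← h2]
  ring

theorem re_trace_mul_of_isHermitian (Y : Matrix (Fin n) (Fin n) ℂ)
    {X : Matrix (Fin n) (Fin n) ℂ} (hX : X.IsHermitian) : (Y * X).trace.re
      = ∑ i, ∑ j, ((Y i j).re * (X i j).re + (Y i j).im * (X i j).im) := by
  simp only [Matrix.trace, Matrix.diag, Matrix.mul_apply, Complex.re_sum]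
  refine Finset.sum_congr rfl fun i _ => Finset.sum_congr rfl fun j _ => ?_
  rw [← hX.apply j i]
  simp

theorem petzCoeff_le {f : ℝ → ℝ} (hf : IsPetzFunction f) {p : Fin n → ℝ} (hp : ∀ j, 0 < p j)
    (i j : Fin n) : petzCoeff f p i j ≤ (p i + p j) / 2 := by
  have hi := hp i
  have hj := hp j
  calc petzCoeff f p i j ≤ p j * ((1 + p i / p j) / 2) :=
        mul_le_mul_of_nonneg_left (hf.le_arithmetic (div_pos hi hj)) hj.le
    _ = (p i + p j) / 2 := by field_simp; ring

theorem inv_petzCoeff_le {f : ℝ → ℝ} (hf : IsPetzFunction f) {p : Fin n → ℝ}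
    (hp : ∀ j, 0 < p j) (i j : Fin n) :
    (petzCoeff f p i j)⁻¹ ≤ ((p i)⁻¹ + (p j)⁻¹) / 2 := by
  have hi := hp i
  have hj := hp j
  have h1 : p j * (2 * (p i / p j) / (1 + p i / p j)) ≤ petzCoeff f p i j :=
    mul_le_mul_of_nonneg_left (hf.harmonic_le (div_pos hi hj)) hj.le
  calc (petzCoeff f p i j)⁻¹ ≤ (p j * (2 * (p i / p j) / (1 + p i / p j)))⁻¹ :=
        inv_anti₀ (by positivity) h1
    _ = ((p i)⁻¹ + (p j)⁻¹) / 2 := by field_simp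

variable {f : ℝ → ℝ}

/-- Monotone metrics are dominated by the one of the harmonic mean. -/
theorem monotoneMetric_le (hf : IsPetzFunction f) {ρ x : Matrix (Fin n) (Fin n) ℂ}
    (hρ : ρ.PosDef) (hx : x.IsHermitian) :
    monotoneMetric f ρ x x ≤ (x * ρ⁻¹ * x).trace.re := by
  obtain ⟨U, p, rfl⟩ := exists_conj_realDiag hρ.1
  have hp := posDef_conj_realDiag_iff.1 hρ
  obtain ⟨X, rfl⟩ := EquivLike.surjective (conjStarAlgAut ℂ _ U) x
  rw [isHermitian_conj_iff] at hx
  rw [inv_conj_realDiag U fun j => (hp j).ne', ← map_mul, ← map_mul, trace_conj,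
    re_trace_mul_realDiag_mul hx, monotoneMetric_conj U hf.pos hp]
  refine Finset.sum_le_sum fun i _ => Finset.sum_le_sum fun j _ => ?_
  have h1 : (star (X i j) * X i j).re = Complex.normSq (X i j) := by
    simp [Complex.normSq_apply]
  rw [h1, div_eq_mul_inv]
  exact mul_le_mul_of_nonneg_left (inv_petzCoeff_le hf hp i j) (Complex.normSq_nonneg _)

/-- The variational lower bound of monotone metrics by the one of the arithmetic mean. -/
theorem le_monotoneMetric (hf : IsPetzFunction f) {ρ x y : Matrix (Fin n) (Fin n) ℂ}
    (hρ : ρ.PosDef) (hx : x.IsHermitian) (hy : y.IsHermitian) :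
    2 * (y * x).trace.re - (y * ρ * y).trace.re ≤ monotoneMetric f ρ x x := by
  obtain ⟨U, p, rfl⟩ := exists_conj_realDiag hρ.1
  have hp := posDef_conj_realDiag_iff.1 hρ
  obtain ⟨X, rfl⟩ := EquivLike.surjective (conjStarAlgAut ℂ _ U) x
  obtain ⟨Y, rfl⟩ := EquivLike.surjective (conjStarAlgAut ℂ _ U) y
  rw [isHermitian_conj_iff] at hx hy
  rw [← map_mul, ← map_mul, ← map_mul, trace_conj, trace_conj,
    re_trace_mul_realDiag_mul hy, monotoneMetric_conj U hf.pos hp,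
    re_trace_mul_of_isHermitian _ hx]
  simp only [Finset.mul_sum, ← Finset.sum_sub_distrib]
  refine Finset.sum_le_sum fun i _ => Finset.sum_le_sum fun j _ => ?_
  have hC := petzCoeff_pos hf.pos hp i j
  have h1 : (star (X i j) * X i j).re = (X i j).re ^ 2 + (X i j).im ^ 2 := by
    simp; ring
  have h2 : Complex.normSq (Y i j) * petzCoeff f p i j
      ≤ Complex.normSq (Y i j) * ((p i + p j) / 2) :=
    mul_le_mul_of_nonneg_left (petzCoeff_le hf hp i j) (Complex.normSq_nonneg _)
  rw [h1]
  refine le_trans (sub_le_sub_left h2 _) ?_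
  rw [le_div_iff₀ hC, Complex.normSq_apply]
  -- Entrywise Young inequality: `2 Re(ȳ x) - C |y|² ≤ |x|² / C`.
  nlinarith [sq_nonneg ((X i j).re - petzCoeff f p i j * (Y i j).re),
    sq_nonneg ((X i j).im - petzCoeff f p i j * (Y i j).im)]

theorem eventually_posDef_add_smul {ρ w : Matrix (Fin n) (Fin n) ℂ} (hρ : ρ.PosDef)
    (hw : w.IsHermitian) : ∀ᶠ s in 𝓝 (0 : ℝ), (ρ + s • w).PosDef := by
  obtain ⟨U, p, rfl⟩ := exists_conj_realDiag hρ.1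
  have hp := posDef_conj_realDiag_iff.1 hρ
  obtain ⟨V, μ, rfl⟩ := exists_conj_realDiag hw
  -- A positive multiple `m` of the identity is split off from `ρ`; it absorbs `s • w` for small
  -- `s`, each summand being diagonal in its own eigenbasis.
  obtain ⟨m, hm, hm0⟩ : ∃ m : ℝ, (∀ j, m < p j) ∧ 0 < m := by
    have h1 : ∀ᶠ m in 𝓝[>] (0 : ℝ), ∀ j, m < p j :=
      eventually_all.2 fun j => nhdsWithin_le_nhds (eventually_lt_nhds (hp j))
    exact (h1.and self_mem_nhdsWithin).exists
  have h2 : ∀ᶠ s in 𝓝 (0 : ℝ), ∀ j, 0 < m + s * μ j := by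
    refine eventually_all.2 fun j => ?_
    have hc : ContinuousAt (fun s : ℝ => m + s * μ j) 0 := by fun_prop
    exact hc.eventually (lt_mem_nhds (by simpa using hm0))
  filter_upwards [h2] with s hs
  have h3 : realDiag p = realDiag (fun j => p j - m) + (m : ℂ) • 1 := by
    ext i j
    by_cases h : i = j
    · subst h; simp [realDiag]
    · simp [realDiag, h]
  have h4 : realDiag (fun j => m + s * μ j) = (m : ℂ) • 1 + (s : ℂ) • realDiag μ := by
    ext i j
    by_cases h : i = j
    · subst h; simp [realDiag]
    · simp [realDiag, h]
  have h5 : conjStarAlgAut ℂ _ U (realDiag p) + s • conjStarAlgAut ℂ _ V (realDiag μ)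
      = conjStarAlgAut ℂ _ U (realDiag fun j => p j - m)
        + conjStarAlgAut ℂ _ V (realDiag fun j => m + s * μ j) := by
    rw [h3, h4]
    simp only [map_add, map_smul, map_one]
    rw [add_assoc, Complex.coe_smul s]
  rw [h5]
  exact (posDef_conj_realDiag_iff.2 fun j => sub_pos.2 (hm j)).add_posSemidef
    (posDef_conj_realDiag_iff.2 hs).posSemidef

theorem hasDerivAt_trace_mul_inv_mul {ρ : Matrix (Fin n) (Fin n) ℂ} (hρ : IsUnit ρ.det)
    (w x : Matrix (Fin n) (Fin n) ℂ) :
    HasDerivAt (fun s : ℝ => (x * (ρ + s • w)⁻¹ * x).trace.re)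
      (-(x * ρ⁻¹ * w * ρ⁻¹ * x).trace.re) 0 := by
  have hline : Continuous fun s : ℝ => ρ + s • w := by fun_prop
  have hinv : ContinuousAt (fun s : ℝ => (ρ + s • w)⁻¹) 0 := by
    have h0 : ContinuousAt (Inv.inv : Matrix (Fin n) (Fin n) ℂ → _) (ρ + (0 : ℝ) • w) := by
      apply continuousAt_matrix_inv
      rw [Ring.inverse_eq_inv']
      exact continuousAt_inv₀ (by simpa using hρ)
    exact ContinuousAt.comp (f := fun s : ℝ => ρ + s • w) h0 hline.continuousAt
  have hdet : ∀ᶠ s in 𝓝 (0 : ℝ), IsUnit (ρ + s • w).det := by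
    have hc : ContinuousAt (fun s : ℝ => (ρ + s • w).det) 0 := hline.matrix_det.continuousAt
    have h1 : ∀ᶠ s in 𝓝 (0 : ℝ), (ρ + s • w).det ≠ 0 :=
      hc.eventually_ne (by simpa using hρ)
    exact h1.mono fun s hs => isUnit_iff_ne_zero.2 hs
  rw [hasDerivAt_iff_tendsto_slope]
  have hlim : Tendsto (fun s : ℝ => -(x * (ρ + s • w)⁻¹ * w * ρ⁻¹ * x).trace.re) (𝓝[≠] 0)
      (𝓝 (-(x * ρ⁻¹ * w * ρ⁻¹ * x).trace.re)) := by
    have hc : Continuous fun M : Matrix (Fin n) (Fin n) ℂ =>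
        -(x * M * w * ρ⁻¹ * x).trace.re := by
      refine (Complex.continuous_re.comp (Continuous.matrix_trace ?_)).neg
      exact (((continuous_const.matrix_mul continuous_id).matrix_mul
        continuous_const).matrix_mul continuous_const).matrix_mul continuous_const
    have h1 := (hc.tendsto _).comp hinv.tendsto
    simp only [Function.comp_def, zero_smul, add_zero] at h1
    exact h1.mono_left nhdsWithin_le_nhds
  refine hlim.congr' ?_
  filter_upwards [nhdsWithin_le_nhds hdet, self_mem_nhdsWithin] with s hs hs0
  have hs0' : s ≠ 0 := hs0
  -- By the resolvent identity the difference quotient is exact, and continuity of inversion gives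
  -- its limit.
  have h1 : (ρ + s • w)⁻¹ = ρ⁻¹ - s • ((ρ + s • w)⁻¹ * w * ρ⁻¹) := by
    have h2 : (ρ + s • w)⁻¹ * (ρ + s • w) * ρ⁻¹ = ρ⁻¹ := by
      rw [Matrix.nonsing_inv_mul _ hs, one_mul]
    rw [mul_add, add_mul, mul_assoc, Matrix.mul_nonsing_inv _ hρ, mul_one] at h2
    rw [eq_sub_iff_add_eq]
    simpa using h2
  have h2 : x * (ρ + s • w)⁻¹ * x
      = x * ρ⁻¹ * x - s • (x * (ρ + s • w)⁻¹ * w * ρ⁻¹ * x) := by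
    conv_lhs => rw [h1]
    simp [mul_sub, sub_mul, mul_assoc]
  rw [slope_def_field, h2]
  simp
  field_simp

theorem HasDerivAt.squeeze {l q u : ℝ → ℝ} {d t : ℝ} (hl : HasDerivAt l d t)
    (hu : HasDerivAt u d t) (hlt : l t = u t) (hlq : ∀ᶠ s in 𝓝 t, l s ≤ q s)
    (hqu : ∀ᶠ s in 𝓝 t, q s ≤ u s) : HasDerivAt q d t := by
  have hlt' : l t = q t := le_antisymm hlq.self_of_nhds (hlt ▸ hqu.self_of_nhds)
  have h2 : (fun s => q s - l s) =o[𝓝 t] fun s => s - t := by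
    rw [hasDerivAt_iff_isLittleO] at *
    have h3 := hu.sub hl
    refine (Asymptotics.IsBigO.of_bound 1 ?_).trans_isLittleO h3
    filter_upwards [hlq, hqu] with s h1 h2
    rw [Real.norm_of_nonneg (by linarith), one_mul]
    refine le_trans ?_ (le_abs_self _)
    simp only [hlt]
    ring_nf
    linarith
  rw [hasDerivAt_iff_isLittleO] at *
  refine (hl.add h2).congr_left fun s => ?_
  rw [hlt']
  ring

/-- A monotone metric, evaluated on a tangent vector commuting with the state, has the same
directional derivatives for every `f`. -/
theorem hasDerivAt_alongLine_monotoneMetric (hf : IsPetzFunction f)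
    {ρ x w : Matrix (Fin n) (Fin n) ℂ} (hρ : ρ.PosDef) (hx : x.IsHermitian)
    (hw : w.IsHermitian) (hxρ : Commute x ρ) :
    HasDerivAt (alongLine (monotoneMetric f) ρ w x x) (-(x * ρ⁻¹ * w * ρ⁻¹ * x).trace.re) 0 := by
  have hdet : IsUnit ρ.det := (Matrix.isUnit_iff_isUnit_det ρ).1 hρ.isUnit
  have hcomm : ρ⁻¹ * x = x * ρ⁻¹ := by
    calc ρ⁻¹ * x = ρ⁻¹ * (x * ρ) * ρ⁻¹ := by
          rw [mul_assoc, mul_assoc, Matrix.mul_nonsing_inv _ hdet, mul_one]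
      _ = x * ρ⁻¹ := by
          rw [hxρ.eq, ← mul_assoc, Matrix.nonsing_inv_mul _ hdet, one_mul]
  -- The vector `x ρ⁻¹`, Hermitian by commutation, is kept fixed in the lower bound: this bound is
  -- then affine in `s` and meets the upper one at `s = 0`.
  have hy : (x * ρ⁻¹).IsHermitian := by
    rw [Matrix.IsHermitian, Matrix.conjTranspose_mul, hρ.inv.1.eq, hx.eq, hcomm]
  have hl : HasDerivAt (fun s : ℝ => 2 * (x * ρ⁻¹ * x).trace.re
      - (x * ρ⁻¹ * (ρ + s • w) * (x * ρ⁻¹)).trace.re) (-(x * ρ⁻¹ * w * ρ⁻¹ * x).trace.re) 0 := by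
    have h1 : (fun s : ℝ => 2 * (x * ρ⁻¹ * x).trace.re
        - (x * ρ⁻¹ * (ρ + s • w) * (x * ρ⁻¹)).trace.re)
        = fun s : ℝ => 2 * (x * ρ⁻¹ * x).trace.re - (x * ρ⁻¹ * ρ * (x * ρ⁻¹)).trace.re
          - s * (x * ρ⁻¹ * w * ρ⁻¹ * x).trace.re := by
      funext s
      have h2 : x * ρ⁻¹ * w * (x * ρ⁻¹) = x * ρ⁻¹ * w * ρ⁻¹ * x := by
        rw [mul_assoc _ ρ⁻¹ x, hcomm]
      rw [mul_add, add_mul, Matrix.trace_add, Complex.add_re, mul_smul_comm, smul_mul_assoc, h2,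
        Matrix.trace_smul, Complex.smul_re, smul_eq_mul]
      ring
    rw [h1]
    simpa using ((hasDerivAt_id (0 : ℝ)).mul_const
      (x * ρ⁻¹ * w * ρ⁻¹ * x).trace.re).const_sub
        (2 * (x * ρ⁻¹ * x).trace.re - (x * ρ⁻¹ * ρ * (x * ρ⁻¹)).trace.re)
  have hpd := eventually_posDef_add_smul hρ hw
  refine HasDerivAt.squeeze hl (hasDerivAt_trace_mul_inv_mul hdet w x) ?_ ?_ ?_
  · simp only [zero_smul, add_zero]
    rw [mul_assoc x ρ⁻¹ ρ, Matrix.nonsing_inv_mul _ hdet, mul_one, mul_assoc x ρ⁻¹ x, hcomm]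
    ring
  · filter_upwards [hpd] with s hs
    exact le_monotoneMetric hf hs hx hy
  · filter_upwards [hpd] with s hs
    exact monotoneMetric_le hf hs hx

end Sandwich

/-! ### Transfer of the geodesic equation to states -/

section Assembly

open Matrix Unitary Filter Topology

variable {n : ℕ}

theorem hasDerivAt_matrix {γ : ℝ → Matrix (Fin n) (Fin n) ℂ} {γ' : Matrix (Fin n) (Fin n) ℂ}
    {t : ℝ} (h : ∀ i j, HasDerivAt (fun s => γ s i j) (γ' i j) t) :
    HasDerivAt γ γ' t := by
  have : HasDerivAt (F := Fin n → Fin n → ℂ) γ γ' t :=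
    hasDerivAt_pi.2 fun i => hasDerivAt_pi.2 fun j => h i j
  exact this

theorem HasDerivAt.matrix_deriv {γ : ℝ → Matrix (Fin n) (Fin n) ℂ}
    {γ' : Matrix (Fin n) (Fin n) ℂ} {t : ℝ} (h : HasDerivAt γ γ' t) : deriv γ t = γ' := by
  have : HasDerivAt (F := Fin n → Fin n → ℂ) γ γ' t := h
  exact this.deriv

theorem HasDerivAt.matrix_differentiableAt {γ : ℝ → Matrix (Fin n) (Fin n) ℂ}
    {γ' : Matrix (Fin n) (Fin n) ℂ} {t : ℝ} (h : HasDerivAt γ γ' t) : DifferentiableAt ℝ γ t := by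
  have : HasDerivAt (F := Fin n → Fin n → ℂ) γ γ' t := h
  exact this.differentiableAt

variable (U : unitary (Matrix (Fin n) (Fin n) ℂ))

theorem hasDerivAt_conj_realDiag {c : ℝ → Fin n → ℝ} {c' : Fin n → ℝ} {t : ℝ}
    (h : HasDerivAt c c' t) :
    HasDerivAt (fun s => conjStarAlgAut ℂ _ U (realDiag (c s)))
      (conjStarAlgAut ℂ _ U (realDiag c')) t := by
  refine hasDerivAt_matrix fun i j => ?_
  have key : ∀ q : Fin n → ℝ, conjStarAlgAut ℂ _ U (realDiag q) i j
      = ∑ k, (U : Matrix (Fin n) (Fin n) ℂ) i k * (q k : ℂ)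
        * (star (U : Matrix (Fin n) (Fin n) ℂ)) k j := fun q => by
    rw [conjStarAlgAut_apply, Matrix.mul_apply]
    simp only [realDiag, Matrix.mul_diagonal]
  simp only [key]
  exact HasDerivAt.fun_sum fun k _ =>
    (((hasDerivAt_pi.1 h k).ofReal_comp).const_mul _).mul_const _

theorem conj_realDiag_mem_nondegenerateStates {p : Fin n → ℝ} (hp : p ∈ weylChamber n) :
    conjStarAlgAut ℂ _ U (realDiag p) ∈ nondegenerateStates n := by
  refine ⟨posDef_conj_realDiag_iff.2 hp.1.1, ?_, ?_⟩
  · rw [trace_conj, realDiag, Matrix.trace_diagonal]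
    exact_mod_cast hp.1.2
  · have h1 : (conjStarAlgAut ℂ _ U (realDiag p)).charpoly = (realDiag p).charpoly := by
      rw [conjStarAlgAut_apply, Matrix.charpoly_mul_comm, ← mul_assoc]
      simp
    rw [h1, realDiag, Matrix.charpoly_diagonal, Polynomial.roots_prod _ _
      (Finset.prod_ne_zero_iff.2 fun i _ => Polynomial.X_sub_C_ne_zero _)]
    simp only [Polynomial.roots_X_sub_C, Multiset.bind_singleton]
    exact Finset.univ.nodup.map (Complex.ofReal_injective.comp hp.2.injective)

variable {f : ℝ → ℝ}

/-- A diagonal argument kills the off-diagonal weights, and `f 1 = 1` makes the diagonal ones `p i`,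
so `f` disappears. -/
theorem monotoneMetric_conj_realDiag (hf : IsPetzFunction f) {p : Fin n → ℝ}
    (hp : ∀ j, 0 < p j) (ξ : Fin n → ℝ) (W : Matrix (Fin n) (Fin n) ℂ) :
    monotoneMetric f (conjStarAlgAut ℂ _ U (realDiag p)) (conjStarAlgAut ℂ _ U (realDiag ξ))
      (conjStarAlgAut ℂ _ U W) = fisherRao p ξ fun j => (W j j).re := by
  rw [monotoneMetric_conj U hf.pos hp, fisherRao]
  refine Finset.sum_congr rfl fun i _ => ?_
  rw [Finset.sum_eq_single i]
  · simp [realDiag, petzCoeff, (hp i).ne', hf.map_one]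
  · intro j _ hj
    simp [realDiag, Ne.symm hj]
  · simp

/-- The line stays diagonal in the same basis, so near `0` the function is literally its Fisher–Rao
counterpart. -/
theorem hasDerivAt_alongLine_conj_realDiag (hf : IsPetzFunction f) {p : Fin n → ℝ}
    (hp : ∀ j, 0 < p j) (ξ : Fin n → ℝ) (W : Matrix (Fin n) (Fin n) ℂ) :
    HasDerivAt (alongLine (monotoneMetric f) (conjStarAlgAut ℂ _ U (realDiag p))
        (conjStarAlgAut ℂ _ U (realDiag ξ)) (conjStarAlgAut ℂ _ U (realDiag ξ))
        (conjStarAlgAut ℂ _ U W))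
      (-∑ j, ξ j * ξ j * (W j j).re / p j ^ 2) 0 := by
  refine (hasDerivAt_alongLine_fisherRao (fun j => (hp j).ne') ξ ξ
    fun j => (W j j).re).congr_of_eventuallyEq ?_
  have h1 : ∀ᶠ s in 𝓝 (0 : ℝ), ∀ j, 0 < (p + s • ξ) j := by
    refine eventually_all.2 fun j => ?_
    have hc : ContinuousAt (fun s : ℝ => (p + s • ξ) j) 0 := by
      simp only [Pi.add_apply, Pi.smul_apply, smul_eq_mul]
      fun_prop
    exact hc.eventually (lt_mem_nhds (by simpa using hp j))
  filter_upwards [h1] with s hs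
  have h2 : realDiag (p + s • ξ) = realDiag p + (s : ℂ) • realDiag ξ := by
    ext i j
    by_cases h : i = j
    · subst h; simp [realDiag]
    · simp [realDiag, h]
  have h3 := monotoneMetric_conj_realDiag U hf hs ξ W
  rw [h2, map_add, map_smul, Complex.coe_smul s] at h3
  exact h3

theorem commute_conj_realDiag (p q : Fin n → ℝ) :
    Commute (conjStarAlgAut ℂ _ U (realDiag p)) (conjStarAlgAut ℂ _ U (realDiag q)) := by
  rw [Commute, SemiconjBy, ← map_mul, ← map_mul, realDiag_mul, realDiag_mul, mul_comm]

/-- Off-diagonal entries of `W` rotate the eigenbasis, but the trapped derivative is a trace against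
a diagonal matrix and sees only the diagonal of `W`. -/
theorem hasDerivAt_alongLine_conj_realDiag_transverse (hf : IsPetzFunction f) {p : Fin n → ℝ}
    (hp : ∀ j, 0 < p j) (ξ : Fin n → ℝ) {W : Matrix (Fin n) (Fin n) ℂ} (hW : W.IsHermitian) :
    HasDerivAt (alongLine (monotoneMetric f) (conjStarAlgAut ℂ _ U (realDiag p))
        (conjStarAlgAut ℂ _ U W) (conjStarAlgAut ℂ _ U (realDiag ξ))
        (conjStarAlgAut ℂ _ U (realDiag ξ)))
      (-∑ j, ξ j * ξ j * (W j j).re / p j ^ 2) 0 := by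
  have h := hasDerivAt_alongLine_monotoneMetric hf (posDef_conj_realDiag_iff (U := U).2 hp)
    ((isHermitian_conj_iff U).2 (realDiag_isHermitian ξ)) ((isHermitian_conj_iff U).2 hW)
    (commute_conj_realDiag U ξ p)
  refine h.congr_deriv ?_
  congr 1
  rw [inv_conj_realDiag U fun j => (hp j).ne', ← map_mul, ← map_mul, ← map_mul, ← map_mul,
    trace_conj, realDiag_mul, mul_assoc, realDiag_mul, Matrix.trace, Complex.re_sum]
  refine Finset.sum_congr rfl fun j _ => ?_
  rw [Matrix.diag_apply, realDiag, realDiag, Matrix.mul_diagonal, Matrix.diagonal_mul]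
  simp
  field_simp

theorem monotoneMetric_add_christoffel (hf : IsPetzFunction f) {p : Fin n → ℝ}
    (hp : ∀ j, 0 < p j) (u ξ : Fin n → ℝ) {W : Matrix (Fin n) (Fin n) ℂ} (hW : W.IsHermitian) :
    monotoneMetric f (conjStarAlgAut ℂ _ U (realDiag p)) (conjStarAlgAut ℂ _ U (realDiag u))
        (conjStarAlgAut ℂ _ U W)
      + christoffel (monotoneMetric f) (conjStarAlgAut ℂ _ U (realDiag p))
        (conjStarAlgAut ℂ _ U (realDiag ξ)) (conjStarAlgAut ℂ _ U (realDiag ξ))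
        (conjStarAlgAut ℂ _ U W)
      = ∑ j, (W j j).re * (u j / p j - ξ j ^ 2 / (2 * p j ^ 2)) := by
  rw [← fisherRao_add_christoffel (fun j => (hp j).ne') u ξ fun j => (W j j).re,
    monotoneMetric_conj_realDiag U hf hp]
  congr 1
  simp only [christoffel, metricDeriv, (hasDerivAt_alongLine_conj_realDiag U hf hp ξ W).deriv,
    (hasDerivAt_alongLine_conj_realDiag_transverse U hf hp ξ hW).deriv,
    (hasDerivAt_alongLine_fisherRao (fun j => (hp j).ne') _ _ _).deriv]
  congr 2
  congr 1
  exact Finset.sum_congr rfl fun j _ => by ring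

theorem isGeodesicOn_conj_frCurve (hf : IsPetzFunction f) {p a : Fin n → ℝ}
    (hp : p ∈ simplex n) {J : Set ℝ} (hJ : ∀ t ∈ J, frCurve p a t ∈ weylChamber n) :
    IsGeodesicOn (nondegenerateStates n) (stateTangent n) (monotoneMetric f) J
      (fun t => conjStarAlgAut ℂ _ U (realDiag (frCurve p a t))) := by
  have h1 := fun t => hasDerivAt_conj_realDiag U (hasDerivAt_frCurve hp.1 a t)
  have h2 := fun t => hasDerivAt_conj_realDiag U (hasDerivAt_frVel hp.1 a t)
  have hd1 : deriv (fun t => conjStarAlgAut ℂ _ U (realDiag (frCurve p a t)))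
      = fun t => conjStarAlgAut ℂ _ U (realDiag (frVel p a t)) :=
    funext fun t => HasDerivAt.matrix_deriv (h1 t)
  have hd2 : deriv (fun t => conjStarAlgAut ℂ _ U (realDiag (frVel p a t)))
      = fun t => conjStarAlgAut ℂ _ U (realDiag (frAcc p a t)) :=
    funext fun t => HasDerivAt.matrix_deriv (h2 t)
  rw [IsGeodesicOn, hd1, hd2]
  refine ⟨fun t ht => ⟨conj_realDiag_mem_nondegenerateStates U (hJ t ht),
    HasDerivAt.matrix_differentiableAt (h1 t), HasDerivAt.matrix_differentiableAt (h2 t)⟩, fun t ht w hw => ?_⟩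
  obtain ⟨W, rfl⟩ := EquivLike.surjective (conjStarAlgAut ℂ _ U) w
  have hW : W.IsHermitian := (isHermitian_conj_iff U).1 hw.1
  have hpos := (hJ t ht).1.1
  refine ⟨(hasDerivAt_alongLine_conj_realDiag U hf hpos _ W).differentiableAt,
    (hasDerivAt_alongLine_conj_realDiag_transverse U hf hpos _ hW).differentiableAt, ?_⟩
  refine (monotoneMetric_add_christoffel U hf hpos _ _ hW).trans ?_
  have htr : ∑ j, (W j j).re = 0 := by
    have h3 : W.trace = 0 := (trace_conj U W).symm.trans hw.2
    simpa [Matrix.trace] using congrArg Complex.re h3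
  simp only [frAcc_sub hp.1 (hpos _)]
  rw [← Finset.sum_mul, htr, zero_mul]

theorem unfolding_eq_conj (U : Matrix.specialUnitaryGroup (Fin n) ℂ) (p : Fin n → ℝ) :
    unfolding U p = conjStarAlgAut ℂ _
      (⟨U.1, (Matrix.mem_specialUnitaryGroup_iff.1 U.2).1⟩ :
        unitary (Matrix (Fin n) (Fin n) ℂ)) (realDiag p) :=
  rfl

theorem lifetime_subset {X : Type*} {S : Set X} {c : ℝ → X} {t : ℝ} (ht : t ∈ lifetime S c) :
    c t ∈ S :=
  connectedComponentIn_subset (c ⁻¹' S) 0 ht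

end Assembly

end UniversalGeodesics

end

theorem mainTheorem3 (n : ℕ) :
    -- the Fisher-Rao geodesics of the open simplex are given by the explicit formula
    (∀ p ∈ UniversalGeodesics.simplex n, ∀ a ∈ UniversalGeodesics.simplexTangent n,
      let c := UniversalGeodesics.frCurve p a
      let J := UniversalGeodesics.lifetime (UniversalGeodesics.simplex n) c
      (IsOpen J ∧ 0 ∈ J ∧ c 0 = p ∧ deriv c 0 = a ∧
        UniversalGeodesics.IsGeodesicOn (UniversalGeodesics.simplex n)
          (UniversalGeodesics.simplexTangent n) UniversalGeodesics.fisherRao J c) ∧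
      ∀ (I : Set ℝ) (q : ℝ → Fin n → ℝ), IsOpen I → I.OrdConnected → 0 ∈ I →
        UniversalGeodesics.IsGeodesicOn (UniversalGeodesics.simplex n)
          (UniversalGeodesics.simplexTangent n) UniversalGeodesics.fisherRao I q →
        q 0 = p → deriv q 0 = a → I ⊆ J ∧ ∀ t ∈ I, q t = c t) ∧
    -- conjugated with a fixed unitary, they are geodesics of every monotone metric
    (∀ p ∈ UniversalGeodesics.weylChamber n, ∀ a ∈ UniversalGeodesics.simplexTangent n,
      ∀ U : Matrix.specialUnitaryGroup (Fin n) ℂ,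
      let c := UniversalGeodesics.frCurve p a
      let J := UniversalGeodesics.lifetime (UniversalGeodesics.weylChamber n) c
      IsOpen J ∧ 0 ∈ J ∧
      ∀ f : ℝ → ℝ, UniversalGeodesics.IsPetzFunction f →
        UniversalGeodesics.IsGeodesicOn (UniversalGeodesics.nondegenerateStates n)
          (UniversalGeodesics.stateTangent n) (UniversalGeodesics.monotoneMetric f) J
          (fun t => UniversalGeodesics.unfolding U (c t))) := by
  open UniversalGeodesics in
  refine ⟨fun p hp a ha => ?_, fun p hp a ha U => ?_⟩
  · intro c J
    have h0 : (0 : ℝ) ∈ c ⁻¹' simplex n := by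
      change frCurve p a 0 ∈ simplex n
      rwa [frCurve_zero]
    refine ⟨⟨(isOpen_preimage_simplex hp ha).connectedComponentIn, mem_connectedComponentIn h0,
      frCurve_zero p a, (hasDerivAt_frCurve hp.1 a 0).deriv.trans (frVel_zero hp.1 a),
      isGeodesicOn_frCurve hp fun t ht => lifetime_subset ht⟩, ?_⟩
    intro I q hI hI' hI0 hq q0 q0'
    have heq := hq.eq_frCurve hI hI' hI0 q0 q0'
    -- Maximality of `J`: on the interval `I` the explicit curve coincides with `q`, hence stays in
    -- the simplex.
    refine ⟨hI'.isPreconnected.subset_connectedComponentIn hI0 fun t ht => ?_, heq⟩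
    change frCurve p a t ∈ simplex n
    rw [← heq t ht]
    exact (hq.1 t ht).1
  · intro c J
    have h0 : (0 : ℝ) ∈ c ⁻¹' weylChamber n := by
      change frCurve p a 0 ∈ weylChamber n
      rwa [frCurve_zero]
    refine ⟨(isOpen_preimage_weylChamber hp.1 ha).connectedComponentIn,
      mem_connectedComponentIn h0, fun f hf => ?_⟩
    simp only [unfolding_eq_conj]
    exact isGeodesicOn_conj_frCurve _ hf hp.1 fun t ht => lifetime_subset ht
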